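/- Let $H$ be an infinite-dimensional complex Hilbert space with inner product $(\cdot,\cdot)$ and norm $\|\cdot\|$, and let $A:\mathcal D(A)\subseteq H\to H$ be a self-adjoint, positive definite operator with compact resolvent. Let $\sigma>0$, $\tau>0$, and let $(\alpha,\beta)\in Q^*$, where $$Q^*:=\Big\{(\alpha,\beta)\in[0,1]\times[0,1]\;\Big|\;\alpha>\frac{\beta+1}{2}\Big\}.$$ Consider the Hilbert space $\mathcal H:=\mathcal D(A^{1/2})\times H\times H\times H$ with inner product $$\langle U_1,U_2\rangle_{\mathcal H}=\sigma(A^{1/2}u_1,A^{1/2}u_2)+(v_1,v_2)+(\theta_1,\theta_2)+\tau(q_1,q_2),\qquad U_i=(u_i,v_i,\theta_i,q_i),$$ and the operator $\mathcal A:\mathcal D(\mathcal A)\subseteq\mathcal H\to\mathcal H$ given by $$\mathcal A(u,v,\theta,q)=\Big(v,\;-(\sigma Au-A^{\alpha}\theta),\;-A^{\alpha}v+A^{\beta/2}q,\;\tfrac1\tau(-q-A^{\beta/2}\theta)\Big),$$ $$\mathcal D(\mathcal A)=\Big\{(u,v,\theta,q)\in\mathcal H\;\Big|\;v\in\mathcal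 D(A^{1/2}),\ \sigma Au-A^{\alpha}\theta\in H,\ -A^{\alpha}v+A^{\beta/2}q\in H,\ q+A^{\beta/2}\theta\in H\Big\},$$ where, for $0\le s\le 1$ and $x\in H$, the element $A^{s}x$ is understood in the extrapolated sense, as the functional $\varphi\mapsto(A^{s}\varphi,x)$ on $\mathcal D(A)$ (written with the inner product antilinear in its first argument), and such a functional belongs to $H$ if it is of the form $\varphi\mapsto(\varphi,w)$ with $w\in H$, in which case it is identified with $w$. Then $\mathcal A$ generates a $C_0$-semigroup of contractions on $\mathcal H$. Moreover, $\sigma(\mathcal A)\cap i\mathbb R=\{0\}$. -/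

import Mathlib

open Filter Topology
open scoped NNReal ComplexConjugate

noncomputable section

/-! ### Unbounded operators: resolvent, spectrum, generation of semigroups -/

section Unbounded

variable {E : Type*} [NormedAddCommGroup E] [NormedSpace ℂ E]

/-- `R` is the bounded everywhere defined two-sided inverse of `z - T : D(T) → E`. -/
structure IsResolventAt (T : E →ₗ.[ℂ] E) (z : ℂ) (R : E →L[ℂ] E) : Prop where
  mem_domain : ∀ y : E, R y ∈ T.domain
  right_inv : ∀ y : E, z • R y - T ⟨R y, mem_domain y⟩ = y
  left_inv : ∀ x : T.domain, R (z • (x : E) - T x) = x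

/-- The resolvent set of an unbounded operator. -/
def unboundedResolventSet (T : E →ₗ.[ℂ] E) : Set ℂ :=
  {z | ∃ R : E →L[ℂ] E, IsResolventAt T z R}

/-- The spectrum of an unbounded operator. -/
def unboundedSpectrum (T : E →ₗ.[ℂ] E) : Set ℂ :=
  (unboundedResolventSet T)ᶜ

/-- The operator has compact resolvent. -/
def HasCompactResolvent (T : E →ₗ.[ℂ] E) : Prop :=
  ∃ z : ℂ, ∃ R : E →L[ℂ] E, IsResolventAt T z R ∧ IsCompactOperator R

/-- A `C₀`-semigroup of bounded operators `(S t)_{t ≥ 0}` on `E`. -/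
structure IsC0Semigroup (S : ℝ≥0 → E →L[ℂ] E) : Prop where
  map_zero : S 0 = ContinuousLinearMap.id ℂ E
  map_add : ∀ s t, S (s + t) = (S s).comp (S t)
  tendsto_zero : ∀ x, Tendsto (fun t => S t x) (𝓝 0) (𝓝 x)

/-- `T` is the (infinitesimal) generator of `S`: its graph consists of all `(x, y)` such that
`(S h x - x) / h → y` as `h ↓ 0`. -/
def IsGeneratorOf (T : E →ₗ.[ℂ] E) (S : ℝ≥0 → E →L[ℂ] E) : Prop :=
  ∀ x y : E, (x, y) ∈ T.graph ↔
    Tendsto (fun h : ℝ≥0 => ((h : ℝ)⁻¹ : ℝ) • (S h x - x)) (𝓝[>] 0) (𝓝 y)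

/-- `T` generates a `C₀`-semigroup of contractions. -/
def GeneratesContractionSemigroup (T : E →ₗ.[ℂ] E) : Prop :=
  ∃ S : ℝ≥0 → E →L[ℂ] E, IsC0Semigroup S ∧ (∀ t, ‖S t‖ ≤ 1) ∧ IsGeneratorOf T S

end Unbounded

/-! ### Positive definite self-adjoint operators with compact resolvent, and their powers -/

variable {H : Type*} [NormedAddCommGroup H] [InnerProductSpace ℂ H] [CompleteSpace H]

/-- `A` is self-adjoint (hence densely defined), positive definite, with compact resolvent. -/
structure IsPosDefCompactResolvent (A : H →ₗ.[ℂ] H) : Prop where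
  selfAdjoint : IsSelfAdjoint A
  pos : ∀ x : A.domain, (x : H) ≠ 0 → 0 < (inner ℂ (A x) (x : H)).re
  compactResolvent : HasCompactResolvent A

namespace IsPosDefCompactResolvent

variable {A : H →ₗ.[ℂ] H}

theorem eq_zero_of_apply_eq_zero (hA : IsPosDefCompactResolvent A) (x : A.domain)
    (hx : A x = 0) : (x : H) = 0 := by
  by_contra h
  have := hA.pos x h
  simp [hx] at this

theorem inner_apply_left (hA : IsPosDefCompactResolvent A) (x y : A.domain) :
    inner ℂ (A x) (y : H) = inner ℂ (x : H) (A y) := by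
  have h := LinearPMap.adjoint_isFormalAdjoint (T := A) hA.selfAdjoint.dense_domain
  rw [LinearPMap.isSelfAdjoint_def.mp hA.selfAdjoint] at h
  exact h x y

theorem exists_bounded_inverse (hA : IsPosDefCompactResolvent A) :
    ∃ B : H →L[ℂ] H, (∀ y, ∃ h : B y ∈ A.domain, A ⟨B y, h⟩ = y) ∧
      ∀ x : A.domain, B (A x) = x := by
  obtain ⟨z, R, hR, hc⟩ := hA.compactResolvent
  by_cases hz : z = 0
  · subst hz
    refine ⟨-R, fun y => ?_, fun x => ?_⟩
    · have h1 : (-R) y ∈ A.domain := A.domain.neg_mem (hR.mem_domain y)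
      refine ⟨h1, ?_⟩
      have h2 := hR.right_inv y
      have h3 : (⟨(-R) y, h1⟩ : A.domain) = -⟨R y, hR.mem_domain y⟩ := rfl
      rw [h3, A.map_neg]
      simpa using h2
    · have h2 := hR.left_inv x
      simpa using h2
  · have key : ∀ x : A.domain, z⁻¹ • (x : H) - R x = -(z⁻¹ • R (A x)) := by
      intro x
      have h := hR.left_inv x
      have h2 : z⁻¹ • (x : H) = z⁻¹ • (z • R x - R (A x)) := by
        rw [← map_smul, ← map_sub, h]
      rw [h2, smul_sub, smul_smul, inv_mul_cancel₀ hz, one_smul]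
      abel
    have key2 : ∀ x y : H, z⁻¹ • x - R x = -(z⁻¹ • R y) →
        ∃ h : x ∈ A.domain, A ⟨x, h⟩ = y := by
      intro x y hxy
      have h1 : x = R (z • x - y) := by
        have h2 : z • (z⁻¹ • x - R x) = z • (-(z⁻¹ • R y)) := by rw [hxy]
        rw [smul_sub, smul_neg, smul_smul, smul_smul, mul_inv_cancel₀ hz, one_smul, one_smul]
          at h2
        rw [map_sub, map_smul]
        rw [← sub_eq_zero] at h2 ⊢
        rw [← h2]
        abel
      have h3 : x ∈ A.domain := h1 ▸ hR.mem_domain _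
      refine ⟨h3, ?_⟩
      have h4 := hR.right_inv (z • x - y)
      have h5 : (⟨R (z • x - y), hR.mem_domain _⟩ : A.domain) = ⟨x, h3⟩ := Subtype.ext h1.symm
      rw [h5, ← h1] at h4
      exact sub_right_injective h4
    rcases hc.hasEigenvalue_or_mem_resolventSet (inv_ne_zero hz) with he | hr
    · exfalso
      obtain ⟨x, hx⟩ := he.exists_hasEigenvector
      have h1 : R x = z⁻¹ • x := hx.apply_eq_smul
      obtain ⟨h, h0⟩ := key2 x 0 (by simp [h1])
      exact hx.2 (hA.eq_zero_of_apply_eq_zero ⟨x, h⟩ h0)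
    · obtain ⟨u, hu⟩ := hr
      have hux : ∀ x : H, (u : H →L[ℂ] H) x = z⁻¹ • x - R x := by
        intro x
        rw [hu]
        simp [Algebra.algebraMap_eq_smul_one]
      refine ⟨-(z⁻¹ • ((↑u⁻¹ : H →L[ℂ] H) * R)), fun y => ?_, fun x => ?_⟩
      · apply key2
        rw [← hux]
        have h1 : ∀ w : H, (u : H →L[ℂ] H) ((↑u⁻¹ : H →L[ℂ] H) w) = w := fun w => by
          rw [← mul_apply_eq_comp, u.mul_inv, one_apply_eq_self]
        simp [h1]
      · have h1 : ∀ w : H, (↑u⁻¹ : H →L[ℂ] H) ((u : H →L[ℂ] H) w) = w := fun w => by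
          rw [← mul_apply_eq_comp, u.inv_mul, one_apply_eq_self]
        have h2 := h1 x
        rw [hux, key x] at h2
        simpa using h2

/-- The bounded inverse `A⁻¹`. -/
def inv (hA : IsPosDefCompactResolvent A) : H →L[ℂ] H :=
  hA.exists_bounded_inverse.choose

theorem inv_mem (hA : IsPosDefCompactResolvent A) (y : H) : hA.inv y ∈ A.domain :=
  (hA.exists_bounded_inverse.choose_spec.1 y).1

theorem apply_inv (hA : IsPosDefCompactResolvent A) (y : H) : A ⟨hA.inv y, hA.inv_mem y⟩ = y :=
  (hA.exists_bounded_inverse.choose_spec.1 y).2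

theorem inv_apply (hA : IsPosDefCompactResolvent A) (x : A.domain) : hA.inv (A x) = x :=
  hA.exists_bounded_inverse.choose_spec.2 x

theorem inv_nonneg (hA : IsPosDefCompactResolvent A) : 0 ≤ hA.inv := by
  rw [ContinuousLinearMap.nonneg_iff_isPositive, ContinuousLinearMap.isPositive_def']
  refine ⟨?_, fun y => ?_⟩
  · rw [ContinuousLinearMap.isSelfAdjoint_iff_isSymmetric]
    intro x y
    have h := hA.inner_apply_left ⟨_, hA.inv_mem x⟩ ⟨_, hA.inv_mem y⟩
    rw [hA.apply_inv, hA.apply_inv] at h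
    exact h.symm
  · by_cases hy : hA.inv y = 0
    · simp [ContinuousLinearMap.reApplyInnerSelf, hy]
    · have h := hA.pos ⟨_, hA.inv_mem y⟩ hy
      rw [hA.apply_inv] at h
      rw [ContinuousLinearMap.reApplyInnerSelf, ← inner_conj_symm, RCLike.conj_re]
      exact h.le

theorem inv_injective (hA : IsPosDefCompactResolvent A) : Function.Injective hA.inv := by
  intro x y h
  rw [← hA.apply_inv x, ← hA.apply_inv y]
  congr 1
  exact Subtype.ext h

/-- The bounded operator `A⁻ˢ := (A⁻¹)ˢ` for `s ≥ 0`, by the continuous functional calculus of the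
bounded positive operator `A⁻¹`. -/
def negPow (hA : IsPosDefCompactResolvent A) (s : ℝ) : H →L[ℂ] H := hA.inv ^ s

/-- The power `Aˢ`, `s ≥ 0`: the inverse of the injective bounded operator `A⁻ˢ`, with domain the
range of `A⁻ˢ`. -/
def pow (hA : IsPosDefCompactResolvent A) (s : ℝ) : H →ₗ.[ℂ] H :=
  ((hA.negPow s).toLinearMap.toPMap ⊤).inverse

theorem negPow_mul_negPow (hA : IsPosDefCompactResolvent A) {s t : ℝ} (hs : 0 ≤ s) (ht : 0 ≤ t) :
    hA.negPow s * hA.negPow t = hA.negPow (s + t) := by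
  have h0 := hA.inv_nonneg
  unfold negPow
  rcases hs.eq_or_lt with rfl | hs
  · rw [CFC.rpow_zero _ h0, one_mul, zero_add]
  rcases ht.eq_or_lt with rfl | ht
  · rw [CFC.rpow_zero _ h0, mul_one, add_zero]
  lift s to ℝ≥0 using hs.le
  lift t to ℝ≥0 using ht.le
  have hs' : 0 < s := by exact_mod_cast hs
  have ht' : 0 < t := by exact_mod_cast ht
  rw [← NNReal.coe_add, ← CFC.nnrpow_eq_rpow hs', ← CFC.nnrpow_eq_rpow ht',
    ← CFC.nnrpow_eq_rpow (add_pos hs' ht'), CFC.nnrpow_add hs' ht']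

theorem negPow_one (hA : IsPosDefCompactResolvent A) : hA.negPow 1 = hA.inv :=
  CFC.rpow_one _ hA.inv_nonneg

theorem negPow_injective (hA : IsPosDefCompactResolvent A) {s : ℝ} (hs : s ∈ Set.Icc (0 : ℝ) 1) :
    Function.Injective (hA.negPow s) := by
  have h := hA.negPow_mul_negPow (sub_nonneg.2 hs.2) hs.1
  rw [sub_add_cancel, negPow_one] at h
  intro x y hxy
  apply hA.inv_injective
  rw [← h, mul_apply_eq_comp, mul_apply_eq_comp, hxy]

theorem mem_pow_domain_iff (hA : IsPosDefCompactResolvent A) {s : ℝ} {x : H} : x ∈ (hA.pow s).domain ↔ ∃ y, hA.negPow s y = x := by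
  rw [pow, LinearPMap.inverse_domain]
  exact ⟨fun ⟨y, hy⟩ => ⟨y, hy⟩, fun ⟨y, hy⟩ => ⟨⟨y, trivial⟩, hy⟩⟩

theorem pow_apply_eq (hA : IsPosDefCompactResolvent A) {s : ℝ} (hs : s ∈ Set.Icc (0 : ℝ) 1)
    (x : (hA.pow s).domain) {y : H} (h : hA.negPow s y = x) : hA.pow s x = y := by
  have hk : LinearMap.ker ((hA.negPow s).toLinearMap.toPMap ⊤).toFun = ⊥ :=
    LinearMap.ker_eq_bot.2 fun a b h => Subtype.ext (hA.negPow_injective hs h)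
  exact LinearPMap.inverse_apply_eq hk (x := ⟨y, trivial⟩) h

theorem domain_le_pow_domain (hA : IsPosDefCompactResolvent A) {s : ℝ}
    (hs : s ∈ Set.Icc (0 : ℝ) 1) : A.domain ≤ (hA.pow s).domain := by
  intro x hx
  rw [hA.mem_pow_domain_iff]
  refine ⟨hA.negPow (1 - s) (A ⟨x, hx⟩), ?_⟩
  rw [← mul_apply_eq_comp, hA.negPow_mul_negPow hs.1 (sub_nonneg.2 hs.2),
    add_sub_cancel, negPow_one, hA.inv_apply]

theorem pow_injective (hA : IsPosDefCompactResolvent A) {s : ℝ} (hs : s ∈ Set.Icc (0 : ℝ) 1)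
    (x : (hA.pow s).domain) (hx : hA.pow s x = 0) : x = 0 := by
  obtain ⟨y, hy⟩ := (hA.mem_pow_domain_iff).1 x.2
  rw [hA.pow_apply_eq hs x hy] at hx
  apply Subtype.ext
  rw [← hy, hx]
  simp

/-- The space in which `H` and all `Aˢ x` (`x ∈ H`, `0 ≤ s ≤ 1`) live: antilinear functionals on
`D(A)`. It contains `D(A⁻ˢ)`, the dual of `D(Aˢ)`, for all `0 ≤ s ≤ 1`. -/
abbrev Extrap (_hA : IsPosDefCompactResolvent A) : Type _ := A.domain →ₗ⋆[ℂ] ℂ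

/-- The embedding of `H` into the extrapolated space, `w ↦ (φ ↦ (φ, w))`. -/
def ofH (hA : IsPosDefCompactResolvent A) : H →ₗ[ℂ] hA.Extrap :=
  LinearMap.flip ((innerₛₗ ℂ).comp A.domain.subtype)

/-- `Aˢ : H → D(A)'` for `0 ≤ s ≤ 1`, the extension by duality of `Aˢ` to all of `H`:
`x ↦ (φ ↦ (Aˢ φ, x))`. -/
def powExt (hA : IsPosDefCompactResolvent A) {s : ℝ} (hs : s ∈ Set.Icc (0 : ℝ) 1) :
    H →ₗ[ℂ] hA.Extrap :=
  LinearMap.flip ((innerₛₗ ℂ).comp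
    ((hA.pow s).toFun.comp (Submodule.inclusion (hA.domain_le_pow_domain hs))))

theorem ofH_apply (hA : IsPosDefCompactResolvent A) (w : H) (φ : A.domain) :
    hA.ofH w φ = inner ℂ (φ : H) w := rfl

theorem powExt_apply (hA : IsPosDefCompactResolvent A) {s : ℝ} (hs : s ∈ Set.Icc (0 : ℝ) 1)
    (x : H) (φ : A.domain) :
    hA.powExt hs x φ = inner ℂ (hA.pow s ⟨φ, hA.domain_le_pow_domain hs φ.2⟩) x := rfl

theorem ofH_injective (hA : IsPosDefCompactResolvent A) (w : H) (hw : hA.ofH w = 0) : w = 0 := by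
  refine hA.selfAdjoint.dense_domain.eq_zero_of_inner_right (𝕜 := ℂ) fun v hv => ?_
  exact LinearMap.congr_fun hw ⟨v, hv⟩

end IsPosDefCompactResolvent

theorem half_mem_Icc : (1 / 2 : ℝ) ∈ Set.Icc (0 : ℝ) 1 := by constructor <;> norm_num

theorem div_two_mem_Icc {β : ℝ} (hβ : β ∈ Set.Icc (0 : ℝ) 1) : β / 2 ∈ Set.Icc (0 : ℝ) 1 :=
  ⟨by linarith [hβ.1], by linarith [hβ.2]⟩

/-! ### The state space and the system operator without inertial term -/

/-- The state space `D(A^{1/2}) × H × H × H` of the system without inertial term; its elements are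
`(u, v, θ, q)`. The parameters `σ, τ > 0` enter through the inner product. -/
def StateSpace {A : H →ₗ.[ℂ] H} (hA : IsPosDefCompactResolvent A) {σ τ : ℝ}
    (_hσ : 0 < σ) (_hτ : 0 < τ) : Type _ :=
  (hA.pow (1 / 2)).domain × H × H × H

namespace StateSpace

variable {A : H →ₗ.[ℂ] H} {hA : IsPosDefCompactResolvent A} {σ τ : ℝ} {hσ : 0 < σ} {hτ : 0 < τ}

instance : AddCommGroup (StateSpace hA hσ hτ) :=
  inferInstanceAs (AddCommGroup ((hA.pow (1 / 2)).domain × H × H × H))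

instance : Module ℂ (StateSpace hA hσ hτ) :=
  inferInstanceAs (Module ℂ ((hA.pow (1 / 2)).domain × H × H × H))

/-- The component `u`. -/
def u : StateSpace hA hσ hτ →ₗ[ℂ] (hA.pow (1 / 2)).domain := LinearMap.fst ℂ _ (H × H × H)

/-- The component `v`. -/
def v : StateSpace hA hσ hτ →ₗ[ℂ] H :=
  (LinearMap.fst ℂ H (H × H)).comp (LinearMap.snd ℂ (hA.pow (1 / 2)).domain (H × H × H))

/-- The component `θ`. -/
def θ : StateSpace hA hσ hτ →ₗ[ℂ] H :=
  ((LinearMap.fst ℂ H H).comp (LinearMap.snd ℂ H (H × H))).comp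
    (LinearMap.snd ℂ (hA.pow (1 / 2)).domain (H × H × H))

/-- The component `q`. -/
def q : StateSpace hA hσ hτ →ₗ[ℂ] H :=
  ((LinearMap.snd ℂ H H).comp (LinearMap.snd ℂ H (H × H))).comp
    (LinearMap.snd ℂ (hA.pow (1 / 2)).domain (H × H × H))

theorem ext_components {U V : StateSpace hA hσ hτ} (h1 : u U = u V) (h2 : v U = v V)
    (h3 : θ U = θ V) (h4 : q U = q V) : U = V :=
  Prod.ext h1 (Prod.ext h2 (Prod.ext h3 h4))

/-- The inner product
`σ (A^{1/2} u₁, A^{1/2} u₂) + (v₁, v₂) + (θ₁, θ₂) + τ (q₁, q₂)` on the state space. -/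
@[reducible]
def core : InnerProductSpace.Core ℂ (StateSpace hA hσ hτ) where
  inner U V := (σ : ℂ) * inner ℂ (hA.pow (1 / 2) (u U)) (hA.pow (1 / 2) (u V))
    + inner ℂ (v U) (v V) + inner ℂ (θ U) (θ V) + (τ : ℂ) * inner ℂ (q U) (q V)
  conj_inner_symm U V := by simp [inner_conj_symm]
  re_inner_nonneg U := by
    simp only [map_add, RCLike.re_to_complex, Complex.re_ofReal_mul]
    have h (x : H) : 0 ≤ (inner ℂ x x).re := inner_self_nonneg (𝕜 := ℂ)
    have h1 := mul_nonneg hσ.le (h (hA.pow (1 / 2) (u U)))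
    have h2 := mul_nonneg hτ.le (h (q U))
    linarith [h (v U), h (θ U)]
  add_left U V W := by
    simp only [map_add, LinearPMap.map_add, inner_add_left]
    ring
  smul_left U V r := by
    simp only [map_smul, LinearPMap.map_smul, inner_smul_left]
    ring
  definite U h := by
    have h0 := congrArg Complex.re h
    simp only [Complex.add_re, Complex.re_ofReal_mul, Complex.zero_re] at h0
    have h (x : H) : 0 ≤ (inner ℂ x x).re := inner_self_nonneg (𝕜 := ℂ)
    have hz (x : H) (hx : (inner ℂ x x).re = 0) : x = 0 := by
      have h5 := inner_self_eq_norm_sq (𝕜 := ℂ) x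
      rw [RCLike.re_to_complex, hx] at h5
      simpa using h5.symm
    have h1 := mul_nonneg hσ.le (h (hA.pow (1 / 2) (u U)))
    have h2 := mul_nonneg hτ.le (h (q U))
    have h3 := h (v U)
    have h4 := h (θ U)
    apply ext_components
    · have e : hA.pow (1 / 2) (u U) = 0 :=
        hz _ ((mul_eq_zero.1 (show σ * _ = 0 by linarith)).resolve_left hσ.ne')
      rw [hA.pow_injective half_mem_Icc _ e, map_zero]
    · rw [hz (v U) (by linarith), map_zero]
    · rw [hz (θ U) (by linarith), map_zero]
    · have e : q U = 0 :=
        hz _ ((mul_eq_zero.1 (show τ * _ = 0 by linarith)).resolve_left hτ.ne')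
      rw [e, map_zero]

instance : NormedAddCommGroup (StateSpace hA hσ hτ) :=
  core.toNormedAddCommGroup

instance : InnerProductSpace ℂ (StateSpace hA hσ hτ) :=
  InnerProductSpace.ofCore core.toCore

theorem inner_def (U V : StateSpace hA hσ hτ) :
    inner ℂ U V = (σ : ℂ) * inner ℂ (hA.pow (1 / 2) (u U)) (hA.pow (1 / 2) (u V))
      + inner ℂ (v U) (v V) + inner ℂ (θ U) (θ V) + (τ : ℂ) * inner ℂ (q U) (q V) := rfl

end StateSpace

open StateSpace in
/-- The graph of the system operator: all pairs `(U, W)` of states with `W = 𝒜 U`, where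
`A u`, `A^α θ`, `A^α v`, `A^{β/2} q`, `A^{β/2} θ` are taken in the extrapolated space and the
equations say that the combinations on the right belong to `H` (for the first equation:
that `v` belongs to `D(A^{1/2})`). -/
def thermoGraph {A : H →ₗ.[ℂ] H} (hA : IsPosDefCompactResolvent A) {σ τ : ℝ}
    (hσ : 0 < σ) (hτ : 0 < τ) {α β : ℝ} (hα : α ∈ Set.Icc (0 : ℝ) 1) (hβ : β ∈ Set.Icc (0 : ℝ) 1) :
    Submodule ℂ (StateSpace hA hσ hτ × StateSpace hA hσ hτ) where
  carrier := {p | (u p.2 : H) = v p.1 ∧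
    hA.ofH (v p.2) = -((σ : ℂ) • hA.powExt (Set.right_mem_Icc.2 zero_le_one) (u p.1 : H)
      - hA.powExt hα (θ p.1)) ∧
    hA.ofH (θ p.2) = -hA.powExt hα (v p.1) + hA.powExt (div_two_mem_Icc hβ) (q p.1) ∧
    hA.ofH (q p.2) = (1 / τ : ℂ) • (-hA.ofH (q p.1) - hA.powExt (div_two_mem_Icc hβ) (θ p.1))}
  zero_mem' := by simp
  add_mem' := by
    rintro p r ⟨h1, h2, h3, h4⟩ ⟨k1, k2, k3, k4⟩
    refine ⟨?_, ?_, ?_, ?_⟩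
    · simp [h1, k1]
    · simp only [Prod.fst_add, Prod.snd_add, map_add, Submodule.coe_add, h2, k2]
      module
    · simp only [Prod.fst_add, Prod.snd_add, map_add, h3, k3]
      module
    · simp only [Prod.fst_add, Prod.snd_add, map_add, h4, k4]
      module
  smul_mem' := by
    rintro c p ⟨h1, h2, h3, h4⟩
    refine ⟨?_, ?_, ?_, ?_⟩
    · simp [h1]
    · simp only [Prod.smul_fst, Prod.smul_snd, map_smul, Submodule.coe_smul, h2]
      module
    · simp only [Prod.smul_fst, Prod.smul_snd, map_smul, h3]
      module
    · simp only [Prod.smul_fst, Prod.smul_snd, map_smul, h4]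
      module

/-- The system operator `𝒜` (without inertial term) on the state space,
`𝒜 (u, v, θ, q) = (v, -(σ A u - A^α θ), -A^α v + A^{β/2} q, τ⁻¹ (-q - A^{β/2} θ))`, with its maximal
domain. -/
def thermoOperator {A : H →ₗ.[ℂ] H} (hA : IsPosDefCompactResolvent A) {σ τ : ℝ}
    (hσ : 0 < σ) (hτ : 0 < τ) {α β : ℝ} (hα : α ∈ Set.Icc (0 : ℝ) 1) (hβ : β ∈ Set.Icc (0 : ℝ) 1) :
    StateSpace hA hσ hτ →ₗ.[ℂ] StateSpace hA hσ hτ :=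
  (thermoGraph hA hσ hτ hα hβ).toLinearPMap

open StateSpace in
theorem thermoOperator_graph {A : H →ₗ.[ℂ] H} (hA : IsPosDefCompactResolvent A) {σ τ : ℝ}
    (hσ : 0 < σ) (hτ : 0 < τ) {α β : ℝ} (hα : α ∈ Set.Icc (0 : ℝ) 1) (hβ : β ∈ Set.Icc (0 : ℝ) 1) :
    (thermoOperator hA hσ hτ hα hβ).graph = thermoGraph hA hσ hτ hα hβ := by
  apply Submodule.toLinearPMap_graph_eq
  rintro ⟨U, W⟩ ⟨h1, h2, h3, h4⟩ (rfl : U = 0)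
  apply ext_components
  · exact Subtype.ext (by simpa using h1)
  · exact (hA.ofH_injective _ (by simpa using h2)).trans (map_zero v).symm
  · exact (hA.ofH_injective _ (by simpa using h3)).trans (map_zero θ).symm
  · exact (hA.ofH_injective _ (by simpa using h4)).trans (map_zero q).symm

/-- The region `Q* = {(α, β) ∈ [0,1] × [0,1] : α > (β + 1) / 2}`. -/
def Qstar : Set (ℝ × ℝ) :=
  {p | p.1 ∈ Set.Icc (0 : ℝ) 1 ∧ p.2 ∈ Set.Icc (0 : ℝ) 1 ∧ p.1 > (p.2 + 1) / 2}

end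

noncomputable section

/-! ### Block diagonal operators on an `ℓ²` sum -/

/-! The operator $A^{-1}$ is compact, positive and injective, so $H$ has a Hilbert basis of its
eigenvectors, with eigenvalues $\mu_i>0$. In suitably weighted coordinates $\mathcal H$ becomes an
$\ell^2$ sum of copies of $\mathbb C^4$, and the graph of $\mathcal A$ consists of all pairs related
block by block by a tridiagonal matrix (`mem_thermoGraph_iff`). This matrix is skew-symmetric with
entries $p=\sqrt\sigma\mu_i^{-1/2}$, $a=\mu_i^{-\alpha}$, $b=\mu_i^{-\beta/2}/\sqrt\tau$, apart from
a damping $\kappa=1/\tau$ in the last component.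

Every block is dissipative, so the block exponentials are contractions and assemble to a contraction
semigroup. Its generator is exactly $\mathcal A$ because the domain is maximal
(`IsL2Coordinates.generatesContractionSemigroup`).

A number $z$ is in the resolvent set exactly when the blocks of $z-\mathcal A$ are bounded below
uniformly in $i$. For $z=i\xi\ne0$ this follows by eliminating all unknowns but the first: the
ratios $p/a$ and $pb/a$ stay bounded because $\alpha\ge(\beta+1)/2$ (`exists_norm_le_thermoBlock`).
At $z=0$ a uniform bound would give $1\le C\sigma\mu_i^{2\alpha-1-\beta}$
(`mul_sq_le_of_norm_le_thermoBlock`). The exponent is positive and in infinite dimensions the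
$\mu_i$ come arbitrarily close to $0$, so $0$ is in the spectrum. -/

/-- `Φ` identifies `X` isometrically with the `ℓ²` sum of copies of `E`. -/
structure IsL2Coordinates {ι E X : Type*} [NormedAddCommGroup E] [NormedSpace ℂ E]
    [NormedAddCommGroup X] [NormedSpace ℂ X] (Φ : X →ₗ[ℂ] ι → E) : Prop where
  hasSum_norm_sq : ∀ x, HasSum (fun i => ‖Φ x i‖ ^ 2) (‖x‖ ^ 2)
  surjective : ∀ f : ι → E, Summable (fun i => ‖f i‖ ^ 2) → ∃ x, Φ x = f

namespace IsL2Coordinates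

section Normed

variable {ι E X : Type*} [NormedAddCommGroup E] [NormedSpace ℂ E]
  [NormedAddCommGroup X] [NormedSpace ℂ X] {Φ : X →ₗ[ℂ] ι → E}

theorem norm_apply_le (hΦ : IsL2Coordinates Φ) (x : X) (i : ι) : ‖Φ x i‖ ≤ ‖x‖ := by
  have h := le_hasSum (hΦ.hasSum_norm_sq x) i fun j _ => sq_nonneg _
  exact (sq_le_sq₀ (norm_nonneg _) (norm_nonneg _)).1 h

theorem injective (hΦ : IsL2Coordinates Φ) {x y : X} (h : ∀ i, Φ x i = Φ y i) : x = y := by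
  have h1 := hΦ.hasSum_norm_sq (x - y)
  have h2 : (fun i => ‖Φ (x - y) i‖ ^ 2) = fun _ => (0 : ℝ) := by
    funext i
    simp [h i]
  rw [h2] at h1
  have h3 := h1.unique hasSum_zero
  exact sub_eq_zero.1 (norm_eq_zero.1 (pow_eq_zero_iff two_ne_zero |>.1 h3))

theorem norm_le_of_forall_norm_apply_le (hΦ : IsL2Coordinates Φ) {C : ℝ} (hC : 0 ≤ C) {x y : X}
    (h : ∀ i, ‖Φ x i‖ ≤ C * ‖Φ y i‖) : ‖x‖ ≤ C * ‖y‖ := by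
  have h1 := hasSum_le (fun i => pow_le_pow_left₀ (norm_nonneg _) (h i) 2)
    (hΦ.hasSum_norm_sq x)
    (by simpa only [mul_pow] using (hΦ.hasSum_norm_sq y).mul_left (C ^ 2))
  rw [← mul_pow] at h1
  exact (sq_le_sq₀ (norm_nonneg _) (by positivity)).1 h1

theorem exists_blockDiagonal (hΦ : IsL2Coordinates Φ) {C : ℝ} (hC : 0 ≤ C) (D : ι → E →ₗ[ℂ] E)
    (hD : ∀ i x, ‖D i x‖ ≤ C * ‖x‖) :
    ∃ T : X →L[ℂ] X, (∀ x i, Φ (T x) i = D i (Φ x i)) ∧ ‖T‖ ≤ C := by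
  have h : ∀ x, ∃ y, Φ y = fun i => D i (Φ x i) := by
    refine fun x => hΦ.surjective _ ?_
    refine Summable.of_nonneg_of_le (fun i => sq_nonneg _)
      (fun i => pow_le_pow_left₀ (norm_nonneg _) (hD i (Φ x i)) 2) ?_
    simpa only [mul_pow] using (hΦ.hasSum_norm_sq x).summable.mul_left (C ^ 2)
  choose T hT using h
  have hT' : ∀ x i, Φ (T x) i = D i (Φ x i) := fun x i => congrFun (hT x) i
  let L : X →ₗ[ℂ] X :=
    { toFun := T
      map_add' := fun x y => hΦ.injective fun i => by simp [hT']
      map_smul' := fun c x => hΦ.injective fun i => by simp [hT'] }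
  have hL : ∀ x, ‖L x‖ ≤ C * ‖x‖ := fun x =>
    hΦ.norm_le_of_forall_norm_apply_le hC fun i => by
      rw [show Φ (L x) i = _ from hT' x i]
      exact hD i _
  exact ⟨L.mkContinuous C hL, hT', L.mkContinuous_norm_le hC hL⟩

/-- Dominated convergence for the series of squared coordinate norms; the fixed vector `w` provides
the summable majorant. -/
theorem tendsto_zero {γ : Type*} {l : Filter γ} [l.IsCountablyGenerated]
    (hΦ : IsL2Coordinates Φ) {f : γ → X} {C : ℝ} (w : X)
    (hf : ∀ i, Tendsto (fun t => Φ (f t) i) l (𝓝 0))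
    (hw : ∀ᶠ t in l, ∀ i, ‖Φ (f t) i‖ ≤ C * ‖Φ w i‖) : Tendsto f l (𝓝 0) := by
  have h1 : Tendsto (fun t => ∑' i, ‖Φ (f t) i‖ ^ 2) l (𝓝 (∑' _ : ι, (0 : ℝ))) := by
    refine tendsto_tsum_of_dominated_convergence (bound := fun i => C ^ 2 * ‖Φ w i‖ ^ 2)
      ((hΦ.hasSum_norm_sq w).summable.mul_left _) (fun i => ?_) ?_
    · have := ((hf i).norm).pow 2
      simpa using this
    · filter_upwards [hw] with t ht i
      rw [Real.norm_of_nonneg (sq_nonneg _), ← mul_pow]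
      exact pow_le_pow_left₀ (norm_nonneg _) (ht i) 2
  rw [tsum_zero] at h1
  have h2 : (fun t => ∑' i, ‖Φ (f t) i‖ ^ 2) = fun t => ‖f t‖ ^ 2 :=
    funext fun t => (hΦ.hasSum_norm_sq (f t)).tsum_eq
  rw [h2] at h1
  have h3 := h1.sqrt
  simp only [Real.sqrt_sq (norm_nonneg _), Real.sqrt_zero] at h3
  exact tendsto_zero_iff_norm_tendsto_zero.2 h3

/-- In finite dimensions a lower bound makes each block of $z-T$ bijective, with inverse bounded by
the same `C`. These inverses form one bounded operator, and it maps into the domain because `hT`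
makes the domain maximal. -/
theorem mem_unboundedResolventSet [FiniteDimensional ℂ E] (hΦ : IsL2Coordinates Φ)
    {T : X →ₗ.[ℂ] X} {M : ι → E →ₗ[ℂ] E}
    (hT : ∀ x y, (x, y) ∈ T.graph ↔ ∀ i, Φ y i = M i (Φ x i)) {z : ℂ} {C : ℝ} (hC : 0 ≤ C)
    (hM : ∀ i x, ‖x‖ ≤ C * ‖z • x - M i x‖) : z ∈ unboundedResolventSet T := by
  have hinj : ∀ i, Function.Injective (z • LinearMap.id - M i : E →ₗ[ℂ] E) := by
    intro i
    rw [injective_iff_map_eq_zero]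
    intro x hx
    have h := hM i x
    rw [show z • x - M i x = 0 from hx] at h
    simpa using h
  let e : ι → E ≃ₗ[ℂ] E := fun i => LinearEquiv.ofInjectiveEndo _ (hinj i)
  have he : ∀ i x, z • (e i).symm x - M i ((e i).symm x) = x :=
    fun i x => (e i).apply_symm_apply x
  have he' : ∀ i x, (e i).symm (z • x - M i x) = x :=
    fun i x => (e i).symm_apply_apply x
  obtain ⟨R, hR, -⟩ := hΦ.exists_blockDiagonal hC (fun i => ((e i).symm : E →ₗ[ℂ] E))
    fun i x => by simpa only [LinearEquiv.coe_coe, he] using hM i ((e i).symm x)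
  simp only [LinearEquiv.coe_coe] at hR
  have hg : ∀ y, (R y, z • R y - y) ∈ T.graph := by
    intro y
    rw [hT]
    intro i
    rw [map_sub, map_smul, Pi.sub_apply, Pi.smul_apply, hR, sub_eq_iff_eq_add,
      ← sub_eq_iff_eq_add', he]
  refine ⟨R, fun y => T.mem_domain_of_mem_graph (hg y), fun y => ?_, fun x => ?_⟩
  · obtain ⟨x, hx1, hx2⟩ := (LinearPMap.mem_graph_iff _).1 (hg y)
    have : (⟨R y, T.mem_domain_of_mem_graph (hg y)⟩ : T.domain) = x := Subtype.ext hx1.symm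
    rw [this, hx2, sub_sub_cancel]
  · apply hΦ.injective
    intro i
    have h1 := (hT _ _).1 (T.mem_graph x) i
    rw [hR, map_sub, map_smul, Pi.sub_apply, Pi.smul_apply, h1, he']

/-- Vectors supported in a single block lie in the domain and stay in that block, so the norm of the
resolvent bounds every block from below. -/
theorem exists_norm_le_of_mem_unboundedResolventSet [DecidableEq ι] (hΦ : IsL2Coordinates Φ)
    {T : X →ₗ.[ℂ] X} {M : ι → E →ₗ[ℂ] E}
    (hT : ∀ x y, (x, y) ∈ T.graph ↔ ∀ i, Φ y i = M i (Φ x i)) {z : ℂ}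
    (hz : z ∈ unboundedResolventSet T) :
    ∃ C : ℝ, 0 ≤ C ∧ ∀ i x, ‖x‖ ≤ C * ‖z • x - M i x‖ := by
  obtain ⟨R, hR⟩ := hz
  refine ⟨‖R‖, norm_nonneg _, fun i x => ?_⟩
  have hs : ∀ y : E, ∃ X₀ : X, Φ X₀ = Pi.single i y := fun y => by
    refine hΦ.surjective _ (summable_of_ne_finset_zero (s := {i}) fun j hj => ?_)
    rw [Pi.single_eq_of_ne (by simpa using hj)]
    simp
  have hn : ∀ (y : E) (X₀ : X), Φ X₀ = Pi.single i y → ‖X₀‖ = ‖y‖ := by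
    intro y X₀ h
    have h1 := hΦ.hasSum_norm_sq X₀
    have h2 : HasSum (fun j => ‖Φ X₀ j‖ ^ 2) (‖y‖ ^ 2) := by
      have := hasSum_single (f := fun j => ‖Φ X₀ j‖ ^ 2) i fun j hj => by
        rw [h, Pi.single_eq_of_ne hj]
        simp
      simpa [h] using this
    have h3 := h1.unique h2
    exact (sq_eq_sq₀ (norm_nonneg _) (norm_nonneg _)).1 h3
  obtain ⟨X₀, hX⟩ := hs x
  obtain ⟨Y, hY⟩ := hs (M i x)
  have hg : (X₀, Y) ∈ T.graph := by
    rw [hT]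
    intro j
    rcases eq_or_ne j i with rfl | hj
    · simp [hX, hY]
    · simp [hX, hY, Pi.single_eq_of_ne hj]
  obtain ⟨x', hx1, hx2⟩ := (LinearPMap.mem_graph_iff _).1 hg
  have h1 := hR.left_inv x'
  simp only at hx1 hx2
  rw [hx1, hx2] at h1
  have h2 : Φ (z • X₀ - Y) = Pi.single i (z • x - M i x) := by
    rw [map_sub, map_smul, hX, hY, Pi.single_sub, Pi.single_smul]
  rw [← hn _ _ hX, ← hn _ _ h2]
  conv_lhs => rw [← h1]
  exact R.le_opNorm _

end Normed

end IsL2Coordinates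

/-! ### The exponential of a dissipative bounded operator -/

section Dissipative

variable {E : Type*} [NormedAddCommGroup E] [InnerProductSpace ℂ E] [CompleteSpace E]

theorem hasDerivAt_exp_smul_apply (M : E →L[ℂ] E) (x : E) (t : ℝ) :
    HasDerivAt (fun s : ℝ => NormedSpace.exp (s • M) x) (NormedSpace.exp (t • M) (M x)) t := by
  have h := hasDerivAt_exp_smul_const (𝕂 := ℝ) M t
  exact ((ContinuousLinearMap.apply ℂ E x).restrictScalars ℝ).hasFDerivAt.comp_hasDerivAt t h

theorem hasDerivAt_exp_smul_apply' (M : E →L[ℂ] E) (x : E) (t : ℝ) :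
    HasDerivAt (fun s : ℝ => NormedSpace.exp (s • M) x) (M (NormedSpace.exp (t • M) x)) t := by
  have h := hasDerivAt_exp_smul_const' (𝕂 := ℝ) M t
  exact ((ContinuousLinearMap.apply ℂ E x).restrictScalars ℝ).hasFDerivAt.comp_hasDerivAt t h

/-- Along the flow, the squared norm has derivative $2\,\mathrm{Re}(My,y)\le0$. The real inner
product structure introduced here is the real part of the complex one. -/
theorem norm_exp_smul_apply_le {M : E →L[ℂ] E} (hM : ∀ x, (inner ℂ (M x) x).re ≤ 0) {t : ℝ}
    (ht : 0 ≤ t) (x : E) : ‖NormedSpace.exp (t • M) x‖ ≤ ‖x‖ := by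
  let _ : InnerProductSpace ℝ E := InnerProductSpace.rclikeToReal ℂ E
  have hd : ∀ s : ℝ, HasDerivAt (fun s : ℝ => ‖NormedSpace.exp (s • M) x‖ ^ 2)
      (2 * inner ℝ (NormedSpace.exp (s • M) x) (M (NormedSpace.exp (s • M) x))) s :=
    fun s => (hasDerivAt_exp_smul_apply' M x s).norm_sq
  have ha : Antitone (fun s : ℝ => ‖NormedSpace.exp (s • M) x‖ ^ 2) := by
    refine antitone_of_deriv_nonpos (fun s => (hd s).differentiableAt) fun s => ?_
    rw [(hd s).deriv]
    have h := hM (NormedSpace.exp (s • M) x)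
    rw [real_inner_comm]
    have h2 : inner ℝ (M (NormedSpace.exp (s • M) x)) (NormedSpace.exp (s • M) x) =
      (inner ℂ (M (NormedSpace.exp (s • M) x)) (NormedSpace.exp (s • M) x)).re := rfl
    linarith
  have h := ha ht
  simp only [zero_smul, NormedSpace.exp_zero] at h
  exact (sq_le_sq₀ (norm_nonneg _) (norm_nonneg _)).1 h

/-- Writing the derivative as $e^{sM}Mx$ bounds it by $\|Mx\|$, with no reference to $\|M\|$. The
blocks of an unbounded operator have no common norm bound, so this is what dominates their
difference quotients. -/
theorem norm_exp_smul_apply_sub_le {M : E →L[ℂ] E} (hM : ∀ x, (inner ℂ (M x) x).re ≤ 0) {t : ℝ}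
    (ht : 0 ≤ t) (x : E) : ‖NormedSpace.exp (t • M) x - x‖ ≤ ‖M x‖ * t := by
  have h := norm_image_sub_le_of_norm_deriv_le_segment' (a := 0) (b := t)
    (f := fun s : ℝ => NormedSpace.exp (s • M) x) (C := ‖M x‖)
    (fun s _ => (hasDerivAt_exp_smul_apply M x s).hasDerivWithinAt)
    (fun s hs => norm_exp_smul_apply_le hM hs.1 (M x)) t (Set.right_mem_Icc.2 ht)
  simpa using h

theorem tendsto_exp_smul_apply_sub (M : E →L[ℂ] E) (x : E) :
    Tendsto (fun h : ℝ≥0 => ((h : ℝ)⁻¹ : ℝ) • (NormedSpace.exp ((h : ℝ) • M) x - x)) (𝓝[>] 0)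
      (𝓝 (M x)) := by
  have h := (hasDerivAt_exp_smul_apply' M x 0).tendsto_slope_zero_right
  simp only [zero_smul, NormedSpace.exp_zero, zero_add] at h
  refine h.comp (tendsto_nhdsWithin_iff.2 ⟨?_, ?_⟩)
  · exact (NNReal.continuous_coe.tendsto' 0 0 rfl).mono_left nhdsWithin_le_nhds
  · filter_upwards [self_mem_nhdsWithin] with t ht using NNReal.coe_pos.2 ht

/-- Limits in $X$ force limits in each coordinate, and the converse is dominated convergence. Hence
the derivative at $0$ of the blockwise exponential exists precisely on the maximal domain. -/
theorem IsL2Coordinates.generatesContractionSemigroup {ι X : Type*} [NormedAddCommGroup X]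
    [NormedSpace ℂ X] {Φ : X →ₗ[ℂ] ι → E} (hΦ : IsL2Coordinates Φ)
    {T : X →ₗ.[ℂ] X} {M : ι → E →L[ℂ] E}
    (hT : ∀ x y, (x, y) ∈ T.graph ↔ ∀ i, Φ y i = M i (Φ x i))
    (hM : ∀ i x, (inner ℂ (M i x) x).re ≤ 0) : GeneratesContractionSemigroup T := by
  have hS : ∀ t : ℝ≥0, ∃ S : X →L[ℂ] X,
      (∀ x i, Φ (S x) i = NormedSpace.exp ((t : ℝ) • M i) (Φ x i)) ∧ ‖S‖ ≤ 1 := fun t =>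
    hΦ.exists_blockDiagonal zero_le_one
      (fun i => (NormedSpace.exp ((t : ℝ) • M i) : E →L[ℂ] E).toLinearMap)
      fun i x => by simpa using norm_exp_smul_apply_le (hM i) t.2 x
  choose S hS hS1 using hS
  have hre : ∀ (r : ℝ) (x : X) (i : ι), Φ (r • x) i = r • Φ x i := fun r x i => by
    rw [← Complex.coe_smul, map_smul, Pi.smul_apply, Complex.coe_smul]
  refine ⟨S, ⟨?_, ?_, ?_⟩, hS1, ?_⟩
  · ext x
    exact hΦ.injective fun i => by simp [hS]
  · intro s t
    ext x
    refine hΦ.injective fun i => ?_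
    let _ : NormedAlgebra ℚ (E →L[ℂ] E) := .restrictScalars ℚ ℂ _
    rw [ContinuousLinearMap.comp_apply, hS, hS, hS, NNReal.coe_add, add_smul,
      NormedSpace.exp_add_of_commute (((Commute.refl (M i)).smul_left _).smul_right _)]
    rfl
  · intro x
    rw [← tendsto_sub_nhds_zero_iff]
    refine hΦ.tendsto_zero (C := 2) x (fun i => ?_) (Eventually.of_forall fun t i => ?_)
    · have h := (hasDerivAt_exp_smul_apply' (M i) (Φ x i) 0).continuousAt.tendsto.comp
        (NNReal.continuous_coe.tendsto' 0 0 rfl)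
      have h2 := h.sub_const (Φ x i)
      simpa [hS, Function.comp_def] using h2
    · rw [map_sub, Pi.sub_apply, hS]
      have h := norm_exp_smul_apply_le (hM i) t.2 (Φ x i)
      have h2 := norm_sub_le (NormedSpace.exp ((t : ℝ) • M i) (Φ x i)) (Φ x i)
      change ‖NormedSpace.exp ((t : ℝ) • M i) (Φ x i)‖ ≤ _ at h
      linarith
  · intro x y
    have hc : ∀ (h : ℝ≥0) i, Φ (((h : ℝ)⁻¹ : ℝ) • (S h x - x)) i =
        ((h : ℝ)⁻¹ : ℝ) • (NormedSpace.exp ((h : ℝ) • M i) (Φ x i) - Φ x i) := fun h i => by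
      rw [hre, map_sub, Pi.sub_apply, hS]
    rw [hT]
    constructor
    · intro hxy
      rw [← tendsto_sub_nhds_zero_iff]
      -- The difference quotient and the limit are each bounded by $\|M_ix_i\|=\|y_i\|$ in block
      -- $i$, which gives the factor 2.
      refine hΦ.tendsto_zero (C := 2) y (fun i => ?_) ?_
      · have h := (tendsto_exp_smul_apply_sub (M i) (Φ x i)).sub_const (M i (Φ x i))
        rw [sub_self] at h
        refine h.congr fun t => ?_
        rw [map_sub, Pi.sub_apply, hc, hxy]
      · filter_upwards [self_mem_nhdsWithin] with t ht i
        have ht' : (0 : ℝ) < t := NNReal.coe_pos.2 ht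
        rw [map_sub, Pi.sub_apply, hc, hxy]
        refine (norm_sub_le _ _).trans ?_
        rw [norm_smul, Real.norm_of_nonneg (inv_nonneg.2 ht'.le), two_mul]
        gcongr
        rw [inv_mul_le_iff₀ ht', mul_comm]
        exact norm_exp_smul_apply_sub_le (hM i) ht'.le _
    · intro hxy i
      have h1 := tendsto_exp_smul_apply_sub (M i) (Φ x i)
      have h2 : Tendsto (fun h : ℝ≥0 => Φ (((h : ℝ)⁻¹ : ℝ) • (S h x - x)) i) (𝓝[>] 0)
          (𝓝 (Φ y i)) := by
        rw [tendsto_iff_norm_sub_tendsto_zero] at hxy ⊢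
        refine squeeze_zero (fun _ => norm_nonneg _) (fun t => ?_) hxy
        rw [← Pi.sub_apply, ← map_sub]
        exact hΦ.norm_apply_le _ _
      have : (𝓝[>] (0 : ℝ≥0)).NeBot := inferInstance
      exact tendsto_nhds_unique (h2.congr fun t => hc t i) h1

end Dissipative


/-! ### The `4 × 4` blocks of the system operator -/

/-- The action of the system operator on one eigenspace, in orthonormal coordinates: a tridiagonal
skew-symmetric matrix, with damping `κ` in the last component. -/
def thermoBlock (p a b κ : ℝ) : EuclideanSpace ℂ (Fin 4) →ₗ[ℂ] EuclideanSpace ℂ (Fin 4) where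
  toFun x := !₂[p * x 1, -(p * x 0) + a * x 2, -(a * x 1) + b * x 3, -(b * x 2) - κ * x 3]
  map_add' x y := by
    ext i
    fin_cases i <;> simp <;> ring
  map_smul' c x := by
    ext i
    fin_cases i <;> simp <;> ring

section Components

variable (p a b κ : ℝ) (x : EuclideanSpace ℂ (Fin 4))

theorem thermoBlock_apply_zero : thermoBlock p a b κ x 0 = p * x 1 := rfl

theorem thermoBlock_apply_one : thermoBlock p a b κ x 1 = -(p * x 0) + a * x 2 := rfl

theorem thermoBlock_apply_two : thermoBlock p a b κ x 2 = -(a * x 1) + b * x 3 := rfl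

theorem thermoBlock_apply_three : thermoBlock p a b κ x 3 = -(b * x 2) - κ * x 3 := rfl

end Components

theorem thermoBlock_dissipative {p a b κ : ℝ} (hκ : 0 ≤ κ) (x : EuclideanSpace ℂ (Fin 4)) :
    (inner ℂ (thermoBlock p a b κ x) x).re ≤ 0 := by
  have h : (inner ℂ (thermoBlock p a b κ x) x).re = -(κ * ((x 3).re ^ 2 + (x 3).im ^ 2)) := by
    rw [PiLp.inner_apply, Fin.sum_univ_four, thermoBlock_apply_zero, thermoBlock_apply_one,
      thermoBlock_apply_two, thermoBlock_apply_three]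
    simp
    ring
  rw [h]
  have : 0 ≤ κ * ((x 3).re ^ 2 + (x 3).im ^ 2) := by positivity
  linarith

/-! ### Resolvent estimates for the blocks -/

/-- On the imaginary axis, the determinant of the reduced system stays away from `0`. -/
theorem le_norm_reduced_det {ξ κ C Y y : ℝ} (hκ : 0 < κ) (hy : |y| ≤ C ^ 2 * |Y|) :
    min (|ξ| / 2) (κ / (2 * (C ^ 2 * (κ ^ 2 + ξ ^ 2) + 1))) ≤
      ‖(ξ * Complex.I + ξ * Complex.I * y + Y / (ξ * Complex.I + κ) : ℂ)‖ := by
  have hd : 0 < κ ^ 2 + ξ ^ 2 := by positivity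
  have hc : (ξ * Complex.I + κ : ℂ) ≠ 0 := fun h => by
    have := congrArg Complex.re h
    simp at this
    exact hκ.ne' this
  have hdc : ((κ : ℂ) ^ 2 + (ξ : ℂ) ^ 2) ≠ 0 := by exact_mod_cast hd.ne'
  have hP : (ξ * Complex.I + ξ * Complex.I * y + Y / (ξ * Complex.I + κ) : ℂ) =
      ((Y * κ / (κ ^ 2 + ξ ^ 2) : ℝ) : ℂ) +
        ((ξ * (1 + y - Y / (κ ^ 2 + ξ ^ 2)) : ℝ) : ℂ) * Complex.I := by
    push_cast
    field_simp
    linear_combination (Y * (ξ : ℂ) ^ 2) * Complex.I_sq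
  rw [hP]
  set P : ℂ := ((Y * κ / (κ ^ 2 + ξ ^ 2) : ℝ) : ℂ) +
        ((ξ * (1 + y - Y / (κ ^ 2 + ξ ^ 2)) : ℝ) : ℂ) * Complex.I with hPdef
  have hre : P.re = Y * κ / (κ ^ 2 + ξ ^ 2) := by simp [hPdef, -Complex.ofReal_mul,
    -Complex.ofReal_div, -Complex.ofReal_add, -Complex.ofReal_sub]
  have him : P.im = ξ * (1 + y - Y / (κ ^ 2 + ξ ^ 2)) := by simp [hPdef, -Complex.ofReal_mul,
    -Complex.ofReal_div, -Complex.ofReal_add, -Complex.ofReal_sub]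
  have hD : 0 < C ^ 2 * (κ ^ 2 + ξ ^ 2) + 1 := by positivity
  -- If $|Y|$ is small, so is $|y|$, and the imaginary part is at least $|\xi|/2$ in modulus.
  -- Otherwise the real part is bounded below. The threshold is where
  -- $C^2|Y|+|Y|/(\kappa^2+\xi^2)=1/2$.
  by_cases h : |Y| * (C ^ 2 * (κ ^ 2 + ξ ^ 2) + 1) ≤ (κ ^ 2 + ξ ^ 2) / 2
  · refine (min_le_left _ _).trans (le_trans ?_ (Complex.abs_im_le_norm P))
    rw [him, abs_mul, div_eq_mul_one_div]
    refine mul_le_mul_of_nonneg_left ?_ (abs_nonneg _)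
    have h1 : |Y / (κ ^ 2 + ξ ^ 2)| = |Y| / (κ ^ 2 + ξ ^ 2) := by rw [abs_div, abs_of_pos hd]
    have h2 : |y| + |Y / (κ ^ 2 + ξ ^ 2)| ≤ 1 / 2 := by
      rw [h1]
      have h3 : C ^ 2 * |Y| + |Y| / (κ ^ 2 + ξ ^ 2) ≤ 1 / 2 := by
        rw [← mul_le_mul_iff_left₀ hd]
        have : (C ^ 2 * |Y| + |Y| / (κ ^ 2 + ξ ^ 2)) * (κ ^ 2 + ξ ^ 2) =
            |Y| * (C ^ 2 * (κ ^ 2 + ξ ^ 2) + 1) := by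
          field_simp
        linarith
      linarith
    refine le_trans ?_ (le_abs_self _)
    linarith [neg_abs_le y, le_abs_self (Y / (κ ^ 2 + ξ ^ 2))]
  · refine (min_le_right _ _).trans (le_trans ?_ (Complex.abs_re_le_norm P))
    push Not at h
    rw [hre, abs_div, abs_mul, abs_of_pos hκ, abs_of_pos hd,
      div_le_div_iff₀ (by positivity) hd]
    nlinarith

/-- The uniform resolvent estimate for the blocks on the imaginary axis. -/
theorem exists_norm_le_thermoBlock {ξ κ C : ℝ} (hξ : ξ ≠ 0) (hκ : 0 < κ) (hC : 0 ≤ C) :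
    ∃ K : ℝ, 0 ≤ K ∧ ∀ p a b : ℝ, 0 < p → 0 < a → 0 < b → p ≤ C * a → p * b ≤ C * a →
      1 ≤ C * p → 1 ≤ C * b → ∀ x : EuclideanSpace ℂ (Fin 4),
        ‖x‖ ≤ K * ‖((ξ : ℂ) * Complex.I) • x - thermoBlock p a b κ x‖ := by
  set δ : ℝ := min (|ξ| / 2) (κ / (2 * (C ^ 2 * (κ ^ 2 + ξ ^ 2) + 1))) with hδ
  have hδ0 : 0 < δ := lt_min (by positivity) (by positivity)
  set K0 : ℝ := δ⁻¹ * (1 + C + C / κ + (C ^ 3 * |ξ| + C ^ 3 / κ) * (C * |ξ| + 1)) with hK0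
  set K1 : ℝ := C * (|ξ| * K0 + 1) with hK1
  set K2 : ℝ := C ^ 2 * (|ξ| * K1 + 1) + C * K0 with hK2
  set K3 : ℝ := κ⁻¹ * (1 + K2) with hK3
  have hK0' : 0 ≤ K0 := by positivity
  have hK1' : 0 ≤ K1 := by positivity
  have hK2' : 0 ≤ K2 := by positivity
  have hK3' : 0 ≤ K3 := by positivity
  refine ⟨2 * (K0 + K1 + K2 + K3), by positivity, fun p a b hp ha hb hpa hpb h1p h1b x => ?_⟩
  set z : ℂ := (ξ : ℂ) * Complex.I with hz
  set g := z • x - thermoBlock p a b κ x with hg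
  have hzn : ‖z‖ = |ξ| := by simp [hz]
  have e0 : z * x 0 - p * x 1 = g 0 := rfl
  have e1 : z * x 1 - (-(p * x 0) + a * x 2) = g 1 := rfl
  have e2 : z * x 2 - (-(a * x 1) + b * x 3) = g 2 := rfl
  have e3 : z * x 3 - (-(b * x 2) - κ * x 3) = g 3 := rfl
  have hN : ∀ i, ‖g i‖ ≤ ‖g‖ := fun i => PiLp.norm_apply_le g i
  set N := ‖g‖ with hNdef
  have hN0 : 0 ≤ N := norm_nonneg _
  have hc : z + κ ≠ 0 := fun h => by
    have := congrArg Complex.re h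
    simp [hz] at this
    exact hκ.ne' this
  have hcn : ‖(z + κ)⁻¹‖ ≤ κ⁻¹ := by
    rw [norm_inv]
    refine inv_anti₀ hκ ?_
    have := Complex.re_le_norm (z + κ)
    simpa [hz] using this
  have hpC : (p : ℂ) ≠ 0 := by exact_mod_cast hp.ne'
  have haC : (a : ℂ) ≠ 0 := by exact_mod_cast ha.ne'
  have hbC : (b : ℂ) ≠ 0 := by exact_mod_cast hb.ne'
  have hip : p⁻¹ ≤ C := by rwa [inv_le_iff_one_le_mul₀ hp]
  have hib : b⁻¹ ≤ C := by rwa [inv_le_iff_one_le_mul₀ hb]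
  have hr : p / a ≤ C := by rwa [div_le_iff₀ ha]
  have hs : p * b / a ≤ C := by rwa [div_le_iff₀ ha]
  have hia : a⁻¹ ≤ C ^ 2 := by
    calc a⁻¹ = p / a * p⁻¹ := by field_simp
      _ ≤ C * C := by gcongr
      _ = C ^ 2 := by ring
  have hba : b / a ≤ C ^ 2 := by
    calc b / a = p * b / a * p⁻¹ := by field_simp
      _ ≤ C * C := by gcongr
      _ = C ^ 2 := by ring
  -- elimination of all unknowns but `x 0`
  set w : ℝ := 1 - ξ ^ 2 / p ^ 2 with hw
  have hz2 : z ^ 2 = -(ξ : ℂ) ^ 2 := by rw [hz, mul_pow, Complex.I_sq]; ring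
  -- Rows 0, 1 and 3 express `x 1`, `x 2` and `x 3` through `x 0`. Inserting them into row 2
  -- multiplied by $p/a$ leaves only coefficients that are bounded uniformly in $p,a,b$.
  have key : (z + z * ((w * (p / a) ^ 2 : ℝ) : ℂ) + ((w * (p * b / a) ^ 2 : ℝ) : ℂ) / (z + κ)) *
      x 0 = g 0 + (p / a : ℝ) * g 2 + (p * b / a : ℝ) * (z + κ)⁻¹ * g 3 +
        ((p / a : ℝ) * z * (a⁻¹ : ℝ) + (p * b / a : ℝ) * (z + κ)⁻¹ * (b / a : ℝ)) *
          ((p⁻¹ : ℝ) * z * g 0 + g 1) := by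
    have hwz : (w : ℂ) = 1 + z ^ 2 / p ^ 2 := by
      rw [hw, hz2]
      push_cast
      ring
    push_cast
    rw [hwz, ← e0, ← e1, ← e2, ← e3]
    field_simp
    ring
  have b0 : ‖x 0‖ ≤ K0 * N := by
    have h1 : δ ≤ ‖z + z * ((w * (p / a) ^ 2 : ℝ) : ℂ) +
        ((w * (p * b / a) ^ 2 : ℝ) : ℂ) / (z + κ)‖ := by
      refine le_norm_reduced_det hκ ?_
      rw [abs_mul, abs_mul, abs_of_nonneg (sq_nonneg (p / a)),
        abs_of_nonneg (sq_nonneg (p * b / a))]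
      calc |w| * (p / a) ^ 2 = b⁻¹ ^ 2 * (|w| * (p * b / a) ^ 2) := by field_simp
        _ ≤ C ^ 2 * (|w| * (p * b / a) ^ 2) := by gcongr
    have h2 := congrArg norm key
    rw [norm_mul] at h2
    have h3 : δ * ‖x 0‖ ≤ δ * K0 * N := by
      refine (mul_le_mul_of_nonneg_right h1 (norm_nonneg _)).trans ?_
      rw [h2, hK0, mul_inv_cancel_left₀ hδ0.ne']
      refine (norm_add_le _ _).trans ?_
      have n1 : ‖g 0 + (p / a : ℝ) * g 2 + (p * b / a : ℝ) * (z + κ)⁻¹ * g 3‖ ≤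
          N + C * N + C * κ⁻¹ * N := by
        refine (norm_add₃_le).trans ?_
        rw [norm_mul, norm_mul, norm_mul, Complex.norm_real, Complex.norm_real,
          Real.norm_of_nonneg (by positivity), Real.norm_of_nonneg (by positivity)]
        have := hN 0
        have := hN 2
        have := hN 3
        gcongr
      have n2 : ‖((p / a : ℝ) * z * (a⁻¹ : ℝ) + (p * b / a : ℝ) * (z + κ)⁻¹ * (b / a : ℝ) : ℂ)‖ ≤
          C * |ξ| * C ^ 2 + C * κ⁻¹ * C ^ 2 := by
        refine (norm_add_le _ _).trans ?_
        simp only [norm_mul, Complex.norm_real, hzn]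
        rw [Real.norm_of_nonneg (by positivity), Real.norm_of_nonneg (by positivity),
          Real.norm_of_nonneg (by positivity), Real.norm_of_nonneg (by positivity)]
        gcongr
      have n3 : ‖((p⁻¹ : ℝ) * z * g 0 + g 1 : ℂ)‖ ≤ C * |ξ| * N + N := by
        refine (norm_add_le _ _).trans ?_
        simp only [norm_mul, Complex.norm_real, hzn]
        rw [Real.norm_of_nonneg (by positivity)]
        have := hN 0
        have := hN 1
        gcongr
      rw [norm_mul]
      refine (add_le_add n1 (mul_le_mul n2 n3 (norm_nonneg _) (by positivity))).trans
        (le_of_eq ?_)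
      ring
    rw [mul_assoc] at h3
    exact le_of_mul_le_mul_left h3 hδ0
  have b1 : ‖x 1‖ ≤ K1 * N := by
    have h1 : x 1 = (p⁻¹ : ℝ) * (z * x 0 - g 0) := by
      push_cast
      rw [← e0]
      field_simp
      ring
    rw [h1, norm_mul, Complex.norm_real, Real.norm_of_nonneg (by positivity), hK1, mul_assoc C]
    refine mul_le_mul hip ((norm_sub_le _ _).trans ?_) (norm_nonneg _) hC
    rw [norm_mul, hzn, add_mul, one_mul, mul_assoc |ξ|]
    have := hN 0
    gcongr
  -- Needed for $c=1$, to bound `x 2`, and for $c=b$, to bound `x 3`: since $b$ has no upper bound,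
  -- the second does not follow from the first.
  have b2' : ∀ c : ℝ, 0 ≤ c → c * a⁻¹ ≤ C ^ 2 → c * (p / a) ≤ C → ‖(c : ℂ) * x 2‖ ≤ K2 * N := by
    intro c hc0 hc1 hc2
    have h1 : (c : ℂ) * x 2 = (c * a⁻¹ : ℝ) * (z * x 1 - g 1) + (c * (p / a) : ℝ) * x 0 := by
      push_cast
      rw [← e1]
      field_simp
      ring
    rw [h1, hK2, add_mul]
    refine (norm_add_le _ _).trans ?_
    rw [norm_mul, norm_mul, Complex.norm_real, Complex.norm_real,
      Real.norm_of_nonneg (by positivity), Real.norm_of_nonneg (by positivity), mul_assoc (C ^ 2),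
      mul_assoc C]
    have h2 : ‖z * x 1 - g 1‖ ≤ (|ξ| * K1 + 1) * N := by
      refine (norm_sub_le _ _).trans ?_
      rw [norm_mul, hzn, add_mul, one_mul, mul_assoc |ξ|]
      have := hN 1
      gcongr
    exact add_le_add (mul_le_mul hc1 h2 (norm_nonneg _) (by positivity))
      (mul_le_mul hc2 b0 (norm_nonneg _) hC)
  have b2 : ‖x 2‖ ≤ K2 * N := by
    have := b2' 1 zero_le_one (by rwa [one_mul]) (by rwa [one_mul])
    simpa using this
  have b3 : ‖x 3‖ ≤ K3 * N := by
    have h0 := b2' b hb.le hba (by rw [← mul_div_assoc, mul_comm b p]; exact hs)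
    have h1 : x 3 = (z + κ)⁻¹ * (g 3 - b * x 2) := by
      rw [← e3]
      field_simp
      ring
    rw [h1, norm_mul, hK3, mul_assoc, add_mul, one_mul]
    refine mul_le_mul hcn ((norm_sub_le _ _).trans ?_) (norm_nonneg _) (by positivity)
    have := hN 3
    gcongr
  have hall : ∀ i, ‖x i‖ ≤ (K0 + K1 + K2 + K3) * N := by
    have k0 := mul_nonneg hK0' hN0
    have k1 := mul_nonneg hK1' hN0
    have k2 := mul_nonneg hK2' hN0
    have k3 := mul_nonneg hK3' hN0
    intro i
    fin_cases i
    · show ‖x 0‖ ≤ _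
      linarith
    · show ‖x 1‖ ≤ _
      linarith
    · show ‖x 2‖ ≤ _
      linarith
    · show ‖x 3‖ ≤ _
      linarith
  rw [EuclideanSpace.norm_eq]
  refine Real.sqrt_le_iff.2 ⟨by positivity, ?_⟩
  refine (Finset.sum_le_sum fun i _ => pow_le_pow_left₀ (norm_nonneg _) (hall i) 2).trans
    (le_of_eq ?_)
  simp
  ring

/-- A resolvent estimate at `0` bounds the coefficients. -/
theorem mul_sq_le_of_norm_le_thermoBlock {p a b κ C : ℝ} (hp : 0 < p) (hb : 0 < b)
    (hκ : 0 < κ) (h : ∀ x, ‖x‖ ≤ C * ‖(0 : ℂ) • x - thermoBlock p a b κ x‖) :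
    κ * a ^ 2 ≤ C * p ^ 2 * b ^ 2 := by
  have hpC : (p : ℂ) ≠ 0 := by exact_mod_cast hp.ne'
  have hbC : (b : ℂ) ≠ 0 := by exact_mod_cast hb.ne'
  -- The preimage of $p\,e_0$, normalised by `x 1 = 1`: row 2 gives `x 3`, row 3 then gives `x 2`,
  -- and row 1 gives `x 0`. The large component `x 0` yields the estimate.
  set x : EuclideanSpace ℂ (Fin 4) :=
    !₂[((-(κ * a ^ 2 / (p * b ^ 2)) : ℝ) : ℂ), 1, -(κ * a / b ^ 2), a / b] with hx
  have h1 : thermoBlock p a b κ x = EuclideanSpace.single 0 (p : ℂ) := by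
    ext i
    fin_cases i
    · simp [thermoBlock, hx]
    · simp [thermoBlock, hx]
      field_simp
      ring
    · simp [thermoBlock, hx]
      field_simp
      ring
    · simp [thermoBlock, hx]
      field_simp
      ring
  have h2 := h x
  rw [h1, zero_smul, zero_sub, norm_neg, PiLp.norm_single, Complex.norm_real,
    Real.norm_of_nonneg hp.le] at h2
  have h3 := (PiLp.norm_apply_le x 0).trans h2
  have h4 : ‖x 0‖ = κ * a ^ 2 / (p * b ^ 2) := by
    rw [show x 0 = ((-(κ * a ^ 2 / (p * b ^ 2)) : ℝ) : ℂ) from rfl, Complex.norm_real, norm_neg,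
      Real.norm_of_nonneg (by positivity)]
  rw [h4, div_le_iff₀ (by positivity)] at h3
  linarith


/-! ### Hilbert bases of eigenvectors -/

universe u

/-- The coordinates of a Hilbert space with respect to a Hilbert basis. -/
def HilbertBasis.coord {H ι : Type*} [NormedAddCommGroup H]
    [InnerProductSpace ℂ H] (b : HilbertBasis ι ℂ H) : H →ₗ[ℂ] ι → ℂ :=
  LinearMap.pi fun i => innerₛₗ ℂ (b i)

theorem HilbertBasis.coord_apply {H ι : Type*} [NormedAddCommGroup H]
    [InnerProductSpace ℂ H] (b : HilbertBasis ι ℂ H) (x : H) (i : ι) :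
    b.coord x i = inner ℂ (b i) x := rfl

theorem HilbertBasis.isL2Coordinates_coord {H ι : Type*} [NormedAddCommGroup H]
    [InnerProductSpace ℂ H] (b : HilbertBasis ι ℂ H)  : IsL2Coordinates b.coord where
  hasSum_norm_sq x := by
    have h := (b.hasSum_inner_mul_inner x x).mapL Complex.reCLM
    have h2 : Complex.reCLM (inner ℂ x x) = ‖x‖ ^ 2 := inner_self_eq_norm_sq (𝕜 := ℂ) x
    rw [h2] at h
    refine h.congr_fun fun i => ?_
    rw [b.coord_apply, ← inner_conj_symm, RCLike.norm_conj, Complex.mul_conj',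
      Complex.reCLM_apply, ← Complex.ofReal_pow, Complex.ofReal_re]
  surjective f hf := by
    have hm : Memℓp f 2 := memℓp_gen (by simpa using hf)
    refine ⟨b.repr.symm ⟨f, hm⟩, ?_⟩
    funext i
    rw [b.coord_apply, ← b.repr_apply_apply, LinearIsometryEquiv.apply_symm_apply]

section Eigenbasis

variable {H : Type u} [NormedAddCommGroup H] [InnerProductSpace ℂ H] [CompleteSpace H]

/-- Orthonormal bases of the eigenspaces, the kernel included, are joined into one family. It is
complete because the eigenspaces of a compact symmetric operator have trivial common orthogonal
complement. -/
theorem exists_hilbertBasis_eigenvectors {T : H →L[ℂ] H} (hc : IsCompactOperator T)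
    (hT : (T : H →ₗ[ℂ] H).IsSymmetric) :
    ∃ (ι : Type u) (b : HilbertBasis ι ℂ H) (μ : ι → ℂ), ∀ i, T (b i) = μ i • b i := by
  have hE : ∀ μ : ℂ, ∃ (w : Set (Module.End.eigenspace (T : H →ₗ[ℂ] H) μ))
      (b : HilbertBasis w ℂ (Module.End.eigenspace (T : H →ₗ[ℂ] H) μ)), ⇑b = ((↑) : w → _) := by
    intro μ
    have hcl : IsClosed ((Module.End.eigenspace (T : H →ₗ[ℂ] H) μ : Submodule ℂ H) : Set H) := by
      have : ((Module.End.eigenspace (T : H →ₗ[ℂ] H) μ : Submodule ℂ H) : Set H) =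
          {x | T x = μ • x} := by
        ext x
        exact Module.End.mem_eigenspace_iff
      rw [this]
      exact isClosed_eq T.continuous (continuous_const_smul μ)
    have : CompleteSpace (Module.End.eigenspace (T : H →ₗ[ℂ] H) μ) := hcl.completeSpace_coe
    exact exists_hilbertBasis ℂ _
  choose w b hb using hE
  have ho : Orthonormal ℂ (fun i : Σ μ, w μ => ((b i.1 i.2 : _) : H)) :=
    hT.orthogonalFamily_eigenspaces.orthonormal_sigma_orthonormal fun μ => (b μ).orthonormal
  have hsp : (Submodule.span ℂ (Set.range fun i : Σ μ, w μ => ((b i.1 i.2 : _) : H)))ᗮ = ⊥ := by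
    rw [eq_bot_iff, ← ContinuousLinearMap.orthogonalComplement_iSup_eigenspaces_eq_bot hc hT]
    intro x hx
    rw [Submodule.mem_orthogonal'] at hx ⊢
    suffices h : ⨆ μ, Module.End.eigenspace (T : H →ₗ[ℂ] H) μ ≤ LinearMap.ker (innerₛₗ ℂ x) from
      fun y hy => h hy
    refine iSup_le fun μ y hy => ?_
    have h1 := (((b μ).hasSum_repr ⟨y, hy⟩).mapL (Submodule.subtypeL _)).mapL (innerSL ℂ x)
    have h2 : ∀ i, innerSL ℂ x (Submodule.subtypeL _ ((b μ).repr ⟨y, hy⟩ i • b μ i)) = 0 :=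
      fun i => by
        have := hx _ (Submodule.subset_span ⟨⟨μ, i⟩, rfl⟩)
        simp [this]
    simp only [h2] at h1
    exact h1.unique hasSum_zero
  refine ⟨_, HilbertBasis.mkOfOrthogonalEqBot ho hsp, fun i => i.1, fun i => ?_⟩
  rw [HilbertBasis.coe_mkOfOrthogonalEqBot]
  exact Module.End.mem_eigenspace_iff.1 (b i.1 i.2).2

/-- Real powers of a positive operator act on eigenvectors as expected. -/
theorem rpow_apply_of_apply_eq_smul {B : H →L[ℂ] H} (hB : 0 ≤ B) {μ : ℝ} (hμ : 0 < μ) {x : H}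
    (hx : B x = (μ : ℂ) • x) {s : ℝ} (hs : 0 ≤ s) : (B ^ s) x = ((μ ^ s : ℝ) : ℂ) • x := by
  have hsa : IsSelfAdjoint B := .of_nonneg hB
  set f : ℝ → ℝ := fun t => t ^ s with hf
  have hfc : Continuous f := Real.continuous_rpow_const hs
  -- With the continuous difference quotient $g$ of $f(t)=t^s$ at $\mu>0$, one has
  -- $f(t)=f(\mu)+g(t)(t-\mu)$. The functional calculus then gives $B^s=f(\mu)+g(B)(B-\mu)$, whose
  -- last factor kills $x$.
  have hg : Continuous (dslope f μ) := by
    rw [← continuousOn_univ, continuousOn_dslope univ_mem]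
    exact ⟨hfc.continuousOn, (Real.hasDerivAt_rpow_const (Or.inl hμ.ne')).differentiableAt⟩
  have h1 : B ^ s = cfc (fun t => f μ + dslope f μ t * (t - μ)) B := by
    rw [CFC.rpow_eq_cfc_real hB]
    refine cfc_congr fun t _ => ?_
    have := sub_smul_dslope f μ t
    simp only [smul_eq_mul] at this
    rw [mul_comm, this]
    ring
  rw [h1, cfc_add B (fun _ => f μ) (fun t => dslope f μ t * (t - μ)) (by fun_prop)
      (hg.mul (by fun_prop)).continuousOn,
    cfc_mul (fun t => dslope f μ t) (fun t => t - μ) B hg.continuousOn,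
    cfc_sub (fun t => t) (fun _ => μ) B, cfc_const _ B, cfc_const _ B, cfc_id' ℝ B]
  have h2 : (B - algebraMap ℝ (H →L[ℂ] H) μ) x = 0 := by
    simp [Algebra.algebraMap_eq_smul_one, hx]
  simp only [add_apply, mul_apply_eq_comp, h2, map_zero, add_zero]
  simp [Algebra.algebraMap_eq_smul_one, hf]

end Eigenbasis

namespace IsPosDefCompactResolvent

variable {H : Type u} [NormedAddCommGroup H] [InnerProductSpace ℂ H] [CompleteSpace H]
  {A : H →ₗ.[ℂ] H}

theorem isCompactOperator_inv (hA : IsPosDefCompactResolvent A) : IsCompactOperator hA.inv := by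
  obtain ⟨z, R, hR, hc⟩ := hA.compactResolvent
  -- Applying $A^{-1}$ to $(z-A)Ry=y$ gives $A^{-1}=(zA^{-1}-1)R$, a bounded operator times a
  -- compact one.
  have h : (hA.inv : H → H) = (z • hA.inv - ContinuousLinearMap.id ℂ H : H →L[ℂ] H) ∘ R := by
    funext y
    have h1 := congrArg hA.inv (hR.right_inv y)
    rw [map_sub, hA.inv_apply, map_smul] at h1
    simpa using h1.symm
  rw [h]
  exact hc.clm_comp _

/-- `b` is a Hilbert basis of eigenvectors of `A⁻¹`, with eigenvalues `μ`. -/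
structure IsEigenbasis (hA : IsPosDefCompactResolvent A) {ι : Type*} (b : HilbertBasis ι ℂ H)
    (μ : ι → ℝ) : Prop where
  inv_apply : ∀ i, hA.inv (b i) = (μ i : ℂ) • b i
  pos : ∀ i, 0 < μ i

theorem exists_isEigenbasis (hA : IsPosDefCompactResolvent A) :
    ∃ (ι : Type u) (b : HilbertBasis ι ℂ H) (μ : ι → ℝ), hA.IsEigenbasis b μ := by
  have hpos := (ContinuousLinearMap.nonneg_iff_isPositive _).1 hA.inv_nonneg
  obtain ⟨ι, b, ν, hb⟩ := exists_hilbertBasis_eigenvectors hA.isCompactOperator_inv hpos.isSymmetric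
  have h1 : ∀ i, inner ℂ (b i) (hA.inv (b i)) = ν i := fun i => by
    rw [hb, inner_smul_right, inner_self_eq_norm_sq_to_K, b.orthonormal.1 i]
    simp
  have h2 : ∀ i, 0 ≤ (ν i).re := fun i => by
    rw [← h1]
    exact hpos.re_inner_nonneg_right _
  have h3 : ∀ i, (((ν i).re : ℝ) : ℂ) = ν i := fun i => by
    rw [← Complex.conj_eq_iff_re, ← h1, inner_conj_symm]
    exact hpos.isSymmetric _ _
  refine ⟨ι, b, fun i => (ν i).re, fun i => ?_, fun i => (h2 i).lt_of_ne fun h => ?_⟩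
  · rw [hb, h3]
  · have h4 : hA.inv (b i) = hA.inv 0 := by
      rw [hb, ← h3, ← h]
      simp
    have h5 := b.orthonormal.1 i
    rw [hA.inv_injective h4] at h5
    simp at h5

theorem inner_negPow_right (hA : IsPosDefCompactResolvent A) (s : ℝ) (x y : H) :
    inner ℂ x (hA.negPow s y) = inner ℂ (hA.negPow s x) y := by
  have h : 0 ≤ hA.negPow s := CFC.rpow_nonneg
  exact (((ContinuousLinearMap.nonneg_iff_isPositive _).1 h).isSymmetric x y).symm

/-! ### The extrapolated space -/

/-- On $D(A)$ one has $A^s\varphi=A^{-(1-s)}A\varphi$, and $A^{-(1-s)}$ is symmetric. Every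
extrapolated term thus lies in the image of the single injective map $A:H\to D(A)'$, so equations
there can be pulled back to $H$. -/
theorem powExt_eq_powExt_one (hA : IsPosDefCompactResolvent A) {s : ℝ}
    (hs : s ∈ Set.Icc (0 : ℝ) 1) (x : H) :
    hA.powExt hs x = hA.powExt (Set.right_mem_Icc.2 zero_le_one) (hA.negPow (1 - s) x) := by
  ext φ
  have h1 : ∀ {t : ℝ} (ht : t ∈ Set.Icc (0 : ℝ) 1),
      hA.pow t ⟨φ, hA.domain_le_pow_domain ht φ.2⟩ = hA.negPow (1 - t) (A φ) := fun {t} ht => by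
    refine hA.pow_apply_eq ht _ ?_
    rw [← mul_apply_eq_comp, hA.negPow_mul_negPow ht.1 (sub_nonneg.2 ht.2), add_sub_cancel,
      negPow_one, hA.inv_apply]
  rw [powExt_apply, powExt_apply, h1 hs,
    h1 (Set.right_mem_Icc.2 zero_le_one), inner_negPow_right, sub_self,
    show hA.negPow 0 = 1 from CFC.rpow_zero _ hA.inv_nonneg]
  rfl

theorem ofH_eq_powExt_one (hA : IsPosDefCompactResolvent A) (w : H) :
    hA.ofH w = hA.powExt (Set.right_mem_Icc.2 zero_le_one) (hA.inv w) := by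
  have h := hA.powExt_eq_powExt_one (Set.left_mem_Icc.2 zero_le_one) w
  rw [sub_zero, negPow_one] at h
  rw [← h]
  ext φ
  rw [ofH_apply, powExt_apply]
  congr 1
  refine (hA.pow_apply_eq (Set.left_mem_Icc.2 zero_le_one) _ ?_).symm
  rw [show hA.negPow 0 = 1 from CFC.rpow_zero _ hA.inv_nonneg]
  rfl

/-- Testing the functional against $\varphi=A^{-1}x$ gives $(x,x)=0$. -/
theorem powExt_one_injective (hA : IsPosDefCompactResolvent A) :
    Function.Injective (hA.powExt (s := 1) (Set.right_mem_Icc.2 zero_le_one)) := by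
  rw [injective_iff_map_eq_zero]
  intro x hx
  refine inner_self_eq_zero (𝕜 := ℂ).1 ?_
  have h := LinearMap.congr_fun hx ⟨hA.inv x, hA.inv_mem x⟩
  rw [powExt_apply, hA.pow_apply_eq (Set.right_mem_Icc.2 zero_le_one) _ (y := x)
    (by rw [negPow_one])] at h
  simpa using h

/-! ### Powers of $A$ in eigencoordinates -/

namespace IsEigenbasis

variable {hA : IsPosDefCompactResolvent A} {ι : Type*} {b : HilbertBasis ι ℂ H} {μ : ι → ℝ}

theorem coord_negPow (hb : hA.IsEigenbasis b μ) {s : ℝ} (hs : 0 ≤ s) (x : H) (i : ι) :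
    b.coord (hA.negPow s x) i = (μ i ^ s : ℝ) * b.coord x i := by
  rw [b.coord_apply, inner_negPow_right, negPow,
    rpow_apply_of_apply_eq_smul hA.inv_nonneg (hb.pos i) (hb.inv_apply i) hs, inner_smul_left,
    Complex.conj_ofReal, b.coord_apply]

theorem coord_inv (hb : hA.IsEigenbasis b μ) (x : H) (i : ι) :
    b.coord (hA.inv x) i = μ i * b.coord x i := by
  rw [← negPow_one, hb.coord_negPow zero_le_one, Real.rpow_one]

theorem coord_pow (hb : hA.IsEigenbasis b μ) {s : ℝ} (hs : s ∈ Set.Icc (0 : ℝ) 1)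
    (x : (hA.pow s).domain) (i : ι) :
    b.coord (hA.pow s x) i = (μ i ^ (-s) : ℝ) * b.coord (x : H) i := by
  obtain ⟨y, hy⟩ := hA.mem_pow_domain_iff.1 x.2
  rw [hA.pow_apply_eq hs x hy, ← hy, hb.coord_negPow hs.1, ← mul_assoc, ← Complex.ofReal_mul,
    ← Real.rpow_add (hb.pos i), neg_add_cancel, Real.rpow_zero, Complex.ofReal_one, one_mul]

theorem le_norm_inv (hb : hA.IsEigenbasis b μ) (i : ι) : μ i ≤ ‖hA.inv‖ := by
  have h := hA.inv.le_opNorm (b i)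
  rwa [hb.inv_apply, norm_smul, b.orthonormal.1 i, Complex.norm_real,
    Real.norm_of_nonneg (hb.pos i).le, mul_one, mul_one] at h

/-- In infinite dimensions the eigenvalues of `A⁻¹` are not bounded away from `0`. -/
theorem finiteDimensional_of_le (hb : hA.IsEigenbasis b μ) {c : ℝ} (hc : 0 < c)
    (h : ∀ i, c ≤ μ i) : FiniteDimensional ℂ H := by
  -- Multiplication by $\mu_i^{-1}$ would be a bounded left inverse of the compact $A^{-1}$, making
  -- the identity compact.
  obtain ⟨T, hT, -⟩ := b.isL2Coordinates_coord.exists_blockDiagonal (_root_.inv_nonneg.2 hc.le)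
    (fun i => ((μ i : ℂ)⁻¹) • LinearMap.id) fun i x => by
      have : ‖(μ i : ℂ)⁻¹‖ ≤ c⁻¹ := by
        rw [norm_inv, Complex.norm_real, Real.norm_of_nonneg (hb.pos i).le]
        exact inv_anti₀ hc (h i)
      simp only [LinearMap.smul_apply, LinearMap.id_apply, norm_smul]
      gcongr
  have hid : T ∘ hA.inv = id := by
    funext x
    refine b.isL2Coordinates_coord.injective fun i => ?_
    have hi : (μ i : ℂ) ≠ 0 := by exact_mod_cast (hb.pos i).ne'
    simp [hT, hb.coord_inv, hi]
  have hcomp := hA.isCompactOperator_inv.clm_comp T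
  rw [hid] at hcomp
  exact FiniteDimensional.of_isCompactOperator_id (𝕜 := ℂ) hcomp

end IsEigenbasis

end IsPosDefCompactResolvent


/-! ### The system operator in coordinates -/

section Coordinates

variable {H : Type*} [NormedAddCommGroup H] [InnerProductSpace ℂ H] [CompleteSpace H]
  {A : H →ₗ.[ℂ] H} {hA : IsPosDefCompactResolvent A} {σ τ : ℝ} {hσ : 0 < σ} {hτ : 0 < τ}
  {ι : Type*} {b : HilbertBasis ι ℂ H} {μ : ι → ℝ}

/-- The orthonormal coordinates on the state space induced by a Hilbert basis of `H`. -/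
def StateSpace.coord (hA : IsPosDefCompactResolvent A) (hσ : 0 < σ) (hτ : 0 < τ)
    (b : HilbertBasis ι ℂ H) : StateSpace hA hσ hτ →ₗ[ℂ] ι → EuclideanSpace ℂ (Fin 4) where
  toFun U i := !₂[(√σ : ℂ) * b.coord (hA.pow (1 / 2) (u U)) i, b.coord (v U) i, b.coord (θ U) i,
    (√τ : ℂ) * b.coord (q U) i]
  map_add' U V := by
    funext i
    ext j
    fin_cases j <;> simp [LinearPMap.map_add, mul_add]
  map_smul' c U := by
    funext i
    ext j
    fin_cases j <;> simp [LinearPMap.map_smul, mul_left_comm]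

theorem StateSpace.isL2Coordinates_coord :
    IsL2Coordinates (StateSpace.coord hA hσ hτ b) where
  hasSum_norm_sq U := by
    have hb := b.isL2Coordinates_coord.hasSum_norm_sq
    have h := ((((hb (hA.pow (1 / 2) (u U))).mul_left σ).add (hb (v U))).add (hb (θ U))).add
      ((hb (q U)).mul_left τ)
    have hn : ‖U‖ ^ 2 = σ * ‖hA.pow (1 / 2) (u U)‖ ^ 2 + ‖v U‖ ^ 2 + ‖θ U‖ ^ 2 + τ * ‖q U‖ ^ 2 := by
      rw [← inner_self_eq_norm_sq (𝕜 := ℂ) U, inner_def]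
      simp only [map_add, RCLike.re_to_complex, Complex.re_ofReal_mul]
      simp only [← RCLike.re_to_complex, inner_self_eq_norm_sq]
    rw [hn]
    refine h.congr_fun fun i => ?_
    rw [EuclideanSpace.norm_sq_eq, Fin.sum_univ_four]
    simp [coord, mul_pow, Real.sq_sqrt hσ.le, Real.sq_sqrt hτ.le, abs_of_nonneg]
  surjective f hf := by
    have hs : ∀ (c : ℂ) (j : Fin 4), ∃ y, b.coord y = fun i => c * f i j := fun c j => by
      refine b.isL2Coordinates_coord.surjective _ ?_
      simp only [norm_mul, mul_pow]
      exact (Summable.of_nonneg_of_le (fun i => sq_nonneg _)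
        (fun i => pow_le_pow_left₀ (norm_nonneg _) (PiLp.norm_apply_le (f i) j) 2) hf).mul_left _
    obtain ⟨y0, h0⟩ := hs (√σ : ℂ)⁻¹ 0
    obtain ⟨y1, h1⟩ := hs 1 1
    obtain ⟨y2, h2⟩ := hs 1 2
    obtain ⟨y3, h3⟩ := hs (√τ : ℂ)⁻¹ 3
    -- The first coordinate is that of $A^{1/2}u$, so the required $u$ is $A^{-1/2}y_0$.
    have hm : hA.negPow (1 / 2) y0 ∈ (hA.pow (1 / 2)).domain := hA.mem_pow_domain_iff.2 ⟨y0, rfl⟩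
    have hσ' : (√σ : ℂ) ≠ 0 := by exact_mod_cast (Real.sqrt_pos.2 hσ).ne'
    have hτ' : (√τ : ℂ) ≠ 0 := by exact_mod_cast (Real.sqrt_pos.2 hτ).ne'
    refine ⟨(⟨_, hm⟩, y1, y2, y3), ?_⟩
    funext i
    ext j
    fin_cases j
    · change (√σ : ℂ) * b.coord (hA.pow (1 / 2) ⟨_, hm⟩) i = _
      rw [hA.pow_apply_eq half_mem_Icc _ rfl, h0, mul_inv_cancel_left₀ hσ']
      rfl
    · change b.coord y1 i = f i 1
      simp [h1]
    · change b.coord y2 i = f i 2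
      simp [h2]
    · change (√τ : ℂ) * b.coord y3 i = _
      rw [h3, mul_inv_cancel_left₀ hτ']
      rfl

open StateSpace in
-- Each extrapolated equation is pulled back to $H$ by $A^{-1}$ and compared coordinatewise, where
-- it appears multiplied by $\mu_i>0$. The weights $\sqrt\sigma$ and $\sqrt\tau$ make the
-- off-diagonal entries skew-symmetric.
theorem mem_thermoGraph_iff (hb : hA.IsEigenbasis b μ) {α β : ℝ} (hα : α ∈ Set.Icc (0 : ℝ) 1)
    (hβ : β ∈ Set.Icc (0 : ℝ) 1) (U W : StateSpace hA hσ hτ) :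
    (U, W) ∈ thermoGraph hA hσ hτ hα hβ ↔ ∀ i, StateSpace.coord hA hσ hτ b W i =
      thermoBlock (√σ * μ i ^ (-(1 / 2) : ℝ)) (μ i ^ (-α)) (μ i ^ (-(β / 2)) / √τ) τ⁻¹
        (StateSpace.coord hA hσ hτ b U i) := by
  have hσ0 := (Real.sqrt_pos.2 hσ).ne'
  have hτ0 := (Real.sqrt_pos.2 hτ).ne'
  have hσ' : (√σ : ℂ) ≠ 0 := by exact_mod_cast hσ0
  have hτ' : (√τ : ℂ) ≠ 0 := by exact_mod_cast hτ0
  have hτ1 : (τ : ℂ) ≠ 0 := by exact_mod_cast hτ.ne'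
  have hτs : (√τ : ℂ) ^ 2 = τ := by exact_mod_cast Real.sq_sqrt hτ.le
  have hσs : (√σ : ℂ) ^ 2 = σ := by exact_mod_cast Real.sq_sqrt hσ.le
  have hμ : ∀ i, (μ i : ℂ) ≠ 0 := fun i => by exact_mod_cast (hb.pos i).ne'
  have hμs : ∀ i (s : ℝ), ((μ i ^ s : ℝ) : ℂ) ≠ 0 := fun i s => by
    exact_mod_cast (Real.rpow_pos_of_pos (hb.pos i) s).ne'
  have hsub : ∀ i (s : ℝ), ((μ i ^ (1 - s) : ℝ) : ℂ) = μ i * (μ i ^ (-s) : ℝ) := fun i s => by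
    rw [sub_eq_add_neg, Real.rpow_add (hb.pos i), Real.rpow_one, Complex.ofReal_mul]
  have hmm : ∀ i, ((μ i ^ (-(1 / 2) : ℝ) : ℝ) : ℂ) * (μ i ^ (-(1 / 2) : ℝ) : ℝ) * μ i = 1 :=
    fun i => by
      rw [← Complex.ofReal_mul, ← Complex.ofReal_mul, ← Real.rpow_add (hb.pos i),
        ← Real.rpow_add_one (hb.pos i).ne']
      norm_num
  have hext : ∀ x y : H, hA.powExt (Set.right_mem_Icc.2 zero_le_one) x =
      hA.powExt (Set.right_mem_Icc.2 zero_le_one) y ↔ ∀ i, b.coord x i = b.coord y i :=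
    fun x y => ⟨fun h i => by rw [hA.powExt_one_injective h],
      fun h => by rw [b.isL2Coordinates_coord.injective h]⟩
  have e1 : ((u W : H) = v U) ↔ ∀ i, (√σ : ℂ) * b.coord (hA.pow (1 / 2) (u W)) i =
      (√σ * μ i ^ (-(1 / 2) : ℝ) : ℝ) * b.coord (v U) i := by
    have h1 : ((u W : H) = v U) ↔ ∀ i, b.coord (u W : H) i = b.coord (v U) i :=
      ⟨fun h i => by rw [h], fun h => b.isL2Coordinates_coord.injective h⟩
    rw [h1]
    refine forall_congr' fun i => ?_
    rw [hb.coord_pow half_mem_Icc, Complex.ofReal_mul, ← mul_assoc,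
      mul_right_inj' (mul_ne_zero hσ' (hμs i _))]
  have e2 : (hA.ofH (v W) = -((σ : ℂ) • hA.powExt (Set.right_mem_Icc.2 zero_le_one) (u U : H)
      - hA.powExt hα (θ U))) ↔ ∀ i, b.coord (v W) i =
      -(((√σ * μ i ^ (-(1 / 2) : ℝ) : ℝ) : ℂ) * (√σ * b.coord (hA.pow (1 / 2) (u U)) i)) +
        (μ i ^ (-α) : ℝ) * b.coord (θ U) i := by
    rw [hA.ofH_eq_powExt_one, hA.powExt_eq_powExt_one hα, ← map_smul, ← map_sub, ← map_neg, hext]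
    refine forall_congr' fun i => ?_
    rw [hb.coord_pow half_mem_Icc, hb.coord_inv]
    simp only [map_neg, map_sub, map_smul, Pi.neg_apply, Pi.sub_apply, Pi.smul_apply, smul_eq_mul]
    rw [hb.coord_negPow (sub_nonneg.2 hα.2), hsub, ← mul_right_inj' (hμ i) (b := b.coord (v W) i),
      Complex.ofReal_mul]
    refine Eq.congr_right ?_
    linear_combination (-(√σ : ℂ) ^ 2 * b.coord (u U : H) i) * (-(hmm i)) +
      b.coord (u U : H) i * hσs
  have e3 : (hA.ofH (θ W) = -hA.powExt hα (v U) + hA.powExt (div_two_mem_Icc hβ) (q U)) ↔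
      ∀ i, b.coord (θ W) i = -(((μ i ^ (-α) : ℝ) : ℂ) * b.coord (v U) i) +
        ((μ i ^ (-(β / 2)) / √τ : ℝ) : ℂ) * (√τ * b.coord (q U) i) := by
    rw [hA.ofH_eq_powExt_one, hA.powExt_eq_powExt_one hα,
      hA.powExt_eq_powExt_one (div_two_mem_Icc hβ), ← map_neg, ← map_add, hext]
    refine forall_congr' fun i => ?_
    rw [hb.coord_inv]
    simp only [map_neg, map_add, Pi.neg_apply, Pi.add_apply]
    rw [hb.coord_negPow (sub_nonneg.2 hα.2), hsub,
      hb.coord_negPow (sub_nonneg.2 (div_two_mem_Icc hβ).2), hsub,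
      ← mul_right_inj' (hμ i) (b := b.coord (θ W) i), Complex.ofReal_div]
    refine Eq.congr_right ?_
    field_simp
  have e4 : (hA.ofH (q W) = (1 / τ : ℂ) • (-hA.ofH (q U) -
      hA.powExt (div_two_mem_Icc hβ) (θ U))) ↔
      ∀ i, (√τ : ℂ) * b.coord (q W) i =
        -(((μ i ^ (-(β / 2)) / √τ : ℝ) : ℂ) * b.coord (θ U) i) -
          (τ⁻¹ : ℝ) * (√τ * b.coord (q U) i) := by
    rw [hA.ofH_eq_powExt_one, hA.ofH_eq_powExt_one,
      hA.powExt_eq_powExt_one (div_two_mem_Icc hβ), ← map_neg, ← map_sub, ← map_smul, hext]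
    refine forall_congr' fun i => ?_
    rw [hb.coord_inv]
    simp only [map_neg, map_sub, map_smul, Pi.neg_apply, Pi.sub_apply, Pi.smul_apply, smul_eq_mul]
    rw [hb.coord_negPow (sub_nonneg.2 (div_two_mem_Icc hβ).2), hsub, hb.coord_inv,
      Complex.ofReal_div, Complex.ofReal_inv, ← hτs]
    have hi := hμ i
    constructor <;> intro h <;> field_simp at h ⊢ <;> linear_combination h
  -- An equality in $\mathbb C^4$ is split into its four components; the right-hand side is left to
  -- unification.
  have hsplit : ∀ i, StateSpace.coord hA hσ hτ b W i =
      thermoBlock (√σ * μ i ^ (-(1 / 2) : ℝ)) (μ i ^ (-α)) (μ i ^ (-(β / 2)) / √τ) τ⁻¹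
        (StateSpace.coord hA hσ hτ b U i) ↔ _ := fun i =>
    (PiLp.ext_iff.trans Fin.forall_fin_succ).trans (and_congr Iff.rfl
      (Fin.forall_fin_succ.trans (and_congr Iff.rfl (Fin.forall_fin_succ.trans
        (and_congr Iff.rfl Fin.forall_fin_one)))))
  simp only [hsplit, forall_and]
  exact and_congr e1 (and_congr e2 (and_congr e3 e4))

end Coordinates


/-! ### The spectrum on the imaginary axis -/

theorem Real.rpow_le_of_le_of_one_le {x B e : ℝ} (hx : 0 ≤ x) (hxB : x ≤ B) (hB : 1 ≤ B)
    (he0 : 0 ≤ e) (he1 : e ≤ 1) : x ^ e ≤ B :=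
  (Real.rpow_le_rpow hx hxB he0).trans (Real.rpow_le_self_of_one_le hB he1)

section Spectrum

variable {H : Type*} [NormedAddCommGroup H] [InnerProductSpace ℂ H] [CompleteSpace H]
  {A : H →ₗ.[ℂ] H} {hA : IsPosDefCompactResolvent A} {σ τ : ℝ} {hσ : 0 < σ} {hτ : 0 < τ}
  {ι : Type*} {b : HilbertBasis ι ℂ H} {μ : ι → ℝ}

theorem mem_thermoOperator_graph_iff (hb : hA.IsEigenbasis b μ) {α β : ℝ}
    (hα : α ∈ Set.Icc (0 : ℝ) 1) (hβ : β ∈ Set.Icc (0 : ℝ) 1) (U W : StateSpace hA hσ hτ) :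
    (U, W) ∈ (thermoOperator hA hσ hτ hα hβ).graph ↔ ∀ i, StateSpace.coord hA hσ hτ b W i =
      thermoBlock (√σ * μ i ^ (-(1 / 2) : ℝ)) (μ i ^ (-α)) (μ i ^ (-(β / 2)) / √τ) τ⁻¹
        (StateSpace.coord hA hσ hτ b U i) := by
  rw [thermoOperator_graph, mem_thermoGraph_iff hb]

theorem imaginary_mem_resolventSet_thermoOperator (hb : hA.IsEigenbasis b μ) {α β : ℝ}
    (hα : α ∈ Set.Icc (0 : ℝ) 1) (hβ : β ∈ Set.Icc (0 : ℝ) 1) (hαβ : (β + 1) / 2 ≤ α) {ξ : ℝ}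
    (hξ : ξ ≠ 0) :
    (ξ : ℂ) * Complex.I ∈ unboundedResolventSet (thermoOperator hA hσ hτ hα hβ) := by
  have hσ0 := Real.sqrt_pos.2 hσ
  have hτ0 := Real.sqrt_pos.2 hτ
  set B : ℝ := max ‖hA.inv‖ 1 with hB
  have hB1 : 1 ≤ B := le_max_right _ _
  have hB0 : 0 < B := one_pos.trans_le hB1
  have hpow : ∀ (i : ι) (e : ℝ), 0 ≤ e → e ≤ 1 → μ i ^ e ≤ B := fun i e =>
    Real.rpow_le_of_le_of_one_le (hb.pos i).le ((hb.le_norm_inv i).trans (le_max_left _ _)) hB1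
  -- In order, the four summands serve $p\le Ca$, $pb\le Ca$, $1\le Cp$ and $1\le Cb$. In each, the
  -- leftover power of $\mu_i$ has exponent in $[0,1]$ and is at most `B`.
  set C : ℝ := (√σ + √σ / √τ + (√σ)⁻¹ + √τ) * B with hC
  have k1 := mul_pos hσ0 hB0
  have k2 := mul_pos (div_pos hσ0 hτ0) hB0
  have k3 := mul_pos (inv_pos.2 hσ0) hB0
  have k4 := mul_pos hτ0 hB0
  have c1 : √σ * B ≤ C := by rw [hC]; linarith
  have c2 : √σ / √τ * B ≤ C := by rw [hC]; linarith
  have c3 : (√σ)⁻¹ * B ≤ C := by rw [hC]; linarith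
  have c4 : √τ * B ≤ C := by rw [hC]; linarith
  obtain ⟨K, hK, hbound⟩ := exists_norm_le_thermoBlock (C := C) hξ (inv_pos.2 hτ)
    (k1.le.trans c1)
  refine StateSpace.isL2Coordinates_coord.mem_unboundedResolventSet
    (mem_thermoOperator_graph_iff hb hα hβ) hK fun i => hbound _ _ _ ?_ ?_ ?_ ?_ ?_ ?_ ?_
  all_goals have hμ := hb.pos i
  · positivity
  · positivity
  · positivity
  · have h : μ i ^ (-(1 / 2) : ℝ) = μ i ^ (α - 1 / 2) * μ i ^ (-α) := by
      rw [← Real.rpow_add hμ]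
      ring_nf
    rw [h, ← mul_assoc]
    refine mul_le_mul_of_nonneg_right (le_trans ?_ c1) (by positivity)
    have := hpow i (α - 1 / 2) (by linarith [hβ.1]) (by linarith [hα.2])
    gcongr
  · have h : √σ * μ i ^ (-(1 / 2) : ℝ) * (μ i ^ (-(β / 2)) / √τ) =
        √σ / √τ * μ i ^ (α - (β + 1) / 2) * μ i ^ (-α) := by
      have h1 : μ i ^ (-(1 / 2) : ℝ) * μ i ^ (-(β / 2)) = μ i ^ (α - (β + 1) / 2) * μ i ^ (-α) := by
        rw [← Real.rpow_add hμ, ← Real.rpow_add hμ]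
        ring_nf
      linear_combination (√σ / √τ) * h1
    rw [h]
    refine mul_le_mul_of_nonneg_right (le_trans ?_ c2) (by positivity)
    have := hpow i (α - (β + 1) / 2) (by linarith) (by linarith [hα.2, hβ.1])
    gcongr
  · have h := hpow i (1 / 2) (by norm_num) (by norm_num)
    calc (1 : ℝ) = (√σ)⁻¹ * μ i ^ (1 / 2 : ℝ) * (√σ * μ i ^ (-(1 / 2) : ℝ)) := by
          rw [Real.rpow_neg hμ.le]
          field_simp
      _ ≤ C * (√σ * μ i ^ (-(1 / 2) : ℝ)) := by
          refine mul_le_mul_of_nonneg_right (le_trans ?_ c3) (by positivity)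
          gcongr
  · have h := hpow i (β / 2) (by linarith [hβ.1]) (by linarith [hβ.2])
    calc (1 : ℝ) = √τ * μ i ^ (β / 2) * (μ i ^ (-(β / 2)) / √τ) := by
          rw [Real.rpow_neg hμ.le]
          field_simp
      _ ≤ C * (μ i ^ (-(β / 2)) / √τ) := by
          refine mul_le_mul_of_nonneg_right (le_trans ?_ c4) (by positivity)
          gcongr

theorem zero_mem_unboundedSpectrum_thermoOperator (hdim : ¬ FiniteDimensional ℂ H)
    (hb : hA.IsEigenbasis b μ) {α β : ℝ} (hα : α ∈ Set.Icc (0 : ℝ) 1)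
    (hβ : β ∈ Set.Icc (0 : ℝ) 1) (hαβ : (β + 1) / 2 < α) :
    0 ∈ unboundedSpectrum (thermoOperator hA hσ hτ hα hβ) := by
  classical
  intro h0
  obtain ⟨C, hC, hbound⟩ :=
    StateSpace.isL2Coordinates_coord.exists_norm_le_of_mem_unboundedResolventSet
      (mem_thermoOperator_graph_iff hb hα hβ) h0
  set e : ℝ := 2 * α - 1 - β with he
  have he0 : 0 < e := by linarith
  have hle : ∀ i, 1 ≤ C * σ * μ i ^ e := by
    intro i
    have hμ := hb.pos i
    have h := mul_sq_le_of_norm_le_thermoBlock (by positivity) (by positivity) (by positivity)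
      (hbound i)
    have h1 : (μ i ^ (-(1 / 2) : ℝ)) ^ 2 * (μ i ^ (-(β / 2))) ^ 2 =
        μ i ^ e * (μ i ^ (-α)) ^ 2 := by
      simp only [← Real.rpow_natCast, ← Real.rpow_mul hμ.le, ← Real.rpow_add hμ]
      congr 1
      push_cast
      rw [he]
      ring
    rw [mul_pow, div_pow, Real.sq_sqrt hσ.le, Real.sq_sqrt hτ.le] at h
    have h2 : C * (σ * (μ i ^ (-(1 / 2) : ℝ)) ^ 2) * ((μ i ^ (-(β / 2))) ^ 2 / τ) =
        C * σ * μ i ^ e * (τ⁻¹ * (μ i ^ (-α)) ^ 2) := by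
      linear_combination (C * σ / τ) * h1
    rw [h2] at h
    have hpos : 0 < τ⁻¹ * (μ i ^ (-α)) ^ 2 := by positivity
    exact le_of_mul_le_mul_right (by rwa [one_mul]) hpos
  -- The summand 1 provides strict positivity, since only $C\ge0$ is known here.
  have hK : 0 < C * σ + 1 := by positivity
  refine hdim (hb.finiteDimensional_of_le (c := ((C * σ + 1)⁻¹) ^ e⁻¹) (by positivity)
    fun i => ?_)
  have hμ := hb.pos i
  rw [Real.rpow_inv_le_iff_of_pos (by positivity) hμ.le he0, inv_le_iff_one_le_mul₀ hK]
  have h3 : 0 < μ i ^ e := by positivity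
  linarith [hle i]

end Spectrum

end

/-! ### Generation and the spectrum on the imaginary axis -/

theorem mainTheorem5 {H : Type*} [NormedAddCommGroup H] [InnerProductSpace ℂ H] [CompleteSpace H]
    (hdim : ¬ FiniteDimensional ℂ H)
    (A : H →ₗ.[ℂ] H) (hA : IsPosDefCompactResolvent A)
    (σ τ : ℝ) (hσ : 0 < σ) (hτ : 0 < τ)
    (α β : ℝ) (hαβ : (α, β) ∈ Qstar) :
    GeneratesContractionSemigroup (thermoOperator hA hσ hτ hαβ.1 hαβ.2.1) ∧
    unboundedSpectrum (thermoOperator hA hσ hτ hαβ.1 hαβ.2.1) ∩ {z : ℂ | z.re = 0} = {0} := by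
  obtain ⟨ι, b, μ, hb⟩ := hA.exists_isEigenbasis
  have hgr := mem_thermoOperator_graph_iff (hσ := hσ) (hτ := hτ) hb hαβ.1 hαβ.2.1
  refine ⟨?_, ?_⟩
  · exact StateSpace.isL2Coordinates_coord.generatesContractionSemigroup
      (M := fun i => LinearMap.toContinuousLinearMap (thermoBlock (√σ * μ i ^ (-(1 / 2) : ℝ))
        (μ i ^ (-α)) (μ i ^ (-(β / 2)) / √τ) τ⁻¹)) hgr
      fun i x => thermoBlock_dissipative (inv_pos.2 hτ).le x
  · ext z
    refine ⟨fun ⟨hz, hre⟩ => ?_, ?_⟩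
    · by_contra hz0
      have him : z.im ≠ 0 := fun h => hz0 (Complex.ext hre h)
      refine hz ?_
      have h : z = (z.im : ℂ) * Complex.I := Complex.ext (by simpa using hre) (by simp)
      rw [h]
      exact imaginary_mem_resolventSet_thermoOperator hb hαβ.1 hαβ.2.1 hαβ.2.2.le him
    · rintro rfl
      exact ⟨zero_mem_unboundedSpectrum_thermoOperator hdim hb hαβ.1 hαβ.2.1 hαβ.2.2, rfl⟩
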